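/- Let $\psi(\rho)=\dfrac{1-\rho\cot\rho}{\rho^2}$ for $\rho\in\mathbb R\setminus\{k\pi:\ k\in\mathbb Z\setminus\{0\}\}$ (with $\psi(0)=\tfrac13$ by continuity), let $\vartheta_1$ be the unique solution of $\tan r=r$ in $(\pi,\tfrac32\pi)$, and let $|\cdot|$ be the Euclidean norm. For $v=(v_1,v_2)\in\mathbb R^2$ with $r=|v|$, $0<r<\vartheta_1$, $r\ne\pi$, put $$\mathrm K_3(v)=2\psi(r)+\frac{\psi'(r)}{r}v_2^2,\qquad \Lambda(v)=v_2\Big[\frac{\psi'(r)}{r}\,v_2\,v+2\psi(r)\,e_2\Big]=\nabla_v\big[v_2^2\,\psi(|v|)\big],$$ where $e_2=(0,1)$. Define $$\Omega_{+,1}=\{v:\ v_1,v_2>0,\ v_1^2+v_2^2<\pi^2\},\qquad \Omega_{-,4}=\{v:\ v_2<0,\ \pi<v_1<|v|<\vartheta_1,\ \mathrm K_3(v)<0\},$$ $$\mathbb R^2_{>,+}=\Big\{(u_1,u_2):\ u_2>\tfrac{2}{\sqrt\pi}\sqrt{u_1}>0\Big\},\qquad \mathbb R^2_{<,+}=\Big\{(u_1,u_2):\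 u_1>0,\ 0<u_2<\tfrac{2}{\sqrt\pi}\sqrt{u_1}\Big\}.$$ For $(x,t)\in\mathbb R^3\times\mathbb R^3$ (the underlying space of the free step-two Carnot group $N_{3,2}$ with three generators) let $$\phi((x,t);\tau)=|x|^2-\psi(|\tau|)\big(|\tau|^2|x|^2-(\tau\cdot x)^2\big)+4\,t\cdot\tau,\qquad \tau\in\mathbb R^3,\ |\tau|\notin\{k\pi:\ k\ge 1\},$$ be the reference function. For $\widetilde u\in\mathbb R^2$ put $u=(\widetilde u,0)\in\mathbb R^3$ and $g_u=(e_1,\tfrac14u)$, where $e_1=(1,0,0)$. Theorem. All four sets above are open, and: (1) $\Lambda$ is a real-analytic diffeomorphism (a real-analytic bijection with real-analytic inverse) from $\Omega_{+,1}$ onto $\mathbb R^2_{>,+}$. Moreover, for every $\widetilde u\in\mathbb R^2_{>,+}$, with $\theta=(\Lambda^{-1}(\widetilde u),0)$, where $\Lambda^{-1}$ is the inverse of $\Lambda|_{\Omega_{+,1}}$, the function $\phi(g_u;\cdot)$ is $C^2$ near $\theta$ and the $3\times3$ Hessian matrix of $-\phi(g_u;\cdot)$ at $\theta$ is positive definite.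 (2) $\Lambda$ is a real-analytic diffeomorphism from $\Omega_{-,4}$ onto $\mathbb R^2_{<,+}$. Moreover, for every $\widetilde u\in\mathbb R^2_{<,+}$, with $\theta=(\Lambda^{-1}(\widetilde u),0)$, where now $\Lambda^{-1}$ is the inverse of $\Lambda|_{\Omega_{-,4}}$, the function $\phi(g_u;\cdot)$ is $C^2$ near $\theta$ and the $3\times3$ Hessian matrix of $\phi(g_u;\cdot)$ at $\theta$ is symmetric, nonsingular, and has exactly two positive eigenvalues, counted with multiplicity. -/

import Mathlib

open Real Set

noncomputable section

namespace FreeCarnot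

/-- The Euclidean plane and the Euclidean 3-space (with their Euclidean norms). -/
abbrev E2 : Type := EuclideanSpace ℝ (Fin 2)

abbrev E3 : Type := EuclideanSpace ℝ (Fin 3)

/-- The points `(x, t)` of the free step-two Carnot group with three generators. Its underlying
space is `ℝ³ × ℝ³`; the group law plays no role for the reference function. -/
abbrev N32 : Type := E3 × E3

/-- `ψ(ρ) = (1 - ρ cot ρ) / ρ²` for `ρ ∉ πℤ`, with its limit `1/3` at the removable singularity
`ρ = 0`. The values at the poles `kπ`, `k ≠ 0`, have no meaning. -/
def psi (ρ : ℝ) : ℝ := if ρ = 0 then 1 / 3 else (1 - ρ * Real.cot ρ) / ρ ^ 2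

/-- The reference function `φ((x,t); τ)`. -/
def phi (g : N32) (τ : E3) : ℝ :=
  ‖g.1‖ ^ 2 - psi ‖τ‖ * (‖τ‖ ^ 2 * ‖g.1‖ ^ 2 - (inner ℝ τ g.1) ^ 2) + 4 * inner ℝ g.2 τ

/-- `K₃(v) = 2 ψ(r) + (ψ'(r) / r) v₂²`, `r = |v|`. -/
def K3 (v : E2) : ℝ := 2 * psi ‖v‖ + deriv psi ‖v‖ / ‖v‖ * v 1 ^ 2

/-- `Λ(v) = v₂ [ (ψ'(r) / r) v₂ v + 2 ψ(r) e₂ ]`, `r = |v|`. -/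
def Lam (v : E2) : E2 :=
  v 1 • ((deriv psi ‖v‖ / ‖v‖ * v 1) • v + (2 * psi ‖v‖) • EuclideanSpace.single 1 (1 : ℝ))

theorem existsUnique_tan_eq_self : ∃! r : ℝ, r ∈ Ioo π (3 * π / 2) ∧ Real.tan r = r := by
  have hpi := Real.pi_pos
  have hcos : ∀ r ∈ Ioo π (3 * π / 2), Real.cos r < 0 := by
    intro r hr
    have h := Real.cos_pos_of_mem_Ioo (x := r - π) ⟨by linarith [hr.1], by linarith [hr.2]⟩
    rw [Real.cos_sub_pi] at h
    linarith
  have hsin : ∀ r ∈ Ioo π (3 * π / 2), Real.sin r < 0 := by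
    intro r hr
    have h := Real.sin_pos_of_pos_of_lt_pi (x := r - π) (by linarith [hr.1]) (by linarith [hr.2])
    rw [Real.sin_sub_pi] at h
    linarith
  have hiff : ∀ r ∈ Ioo π (3 * π / 2),
      (Real.tan r = r ↔ Real.sin r - r * Real.cos r = 0) := by
    intro r hr
    rw [Real.tan_eq_sin_div_cos, div_eq_iff (hcos r hr).ne, sub_eq_zero]
  have hcont : ContinuousOn (fun r : ℝ => Real.sin r - r * Real.cos r) (Icc π (3 * π / 2)) := by
    fun_prop
  have hanti : StrictAntiOn (fun r : ℝ => Real.sin r - r * Real.cos r) (Icc π (3 * π / 2)) := by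
    apply strictAntiOn_of_deriv_neg (convex_Icc _ _) hcont
    intro x hx
    rw [interior_Icc] at hx
    have hd : HasDerivAt (fun r : ℝ => Real.sin r - r * Real.cos r)
        (Real.cos x - (1 * Real.cos x + x * (-Real.sin x))) x :=
      (Real.hasDerivAt_sin x).sub ((hasDerivAt_id x).mul (Real.hasDerivAt_cos x))
    rw [hd.deriv]
    nlinarith [hsin x hx, hx.1]
  have h0 : Real.sin (3 * π / 2) - 3 * π / 2 * Real.cos (3 * π / 2) < 0 := by
    have e : 3 * π / 2 = π / 2 + π := by ring
    rw [e, Real.sin_add_pi, Real.cos_add_pi]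
    simp
  have h1 : 0 < Real.sin π - π * Real.cos π := by simp [hpi]
  obtain ⟨r, hr, hr0⟩ := intermediate_value_Ioo' (by linarith) hcont ⟨h0, h1⟩
  refine ⟨r, ⟨hr, (hiff r hr).2 hr0⟩, ?_⟩
  rintro s ⟨hs, hs0⟩
  exact hanti.injOn (Ioo_subset_Icc_self hs) (Ioo_subset_Icc_self hr)
    (((hiff s hs).1 hs0).trans hr0.symm)

/-- `ϑ₁`, the unique solution of `tan r = r` in `(π, 3π/2)`. -/
def vartheta1 : ℝ := existsUnique_tan_eq_self.choose

theorem vartheta1_spec : vartheta1 ∈ Ioo π (3 * π / 2) ∧ Real.tan vartheta1 = vartheta1 :=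
  existsUnique_tan_eq_self.choose_spec.1

/-- `Ω_{+,1}`. -/
def OmegaPlus : Set E2 := {v | 0 < v 0 ∧ 0 < v 1 ∧ v 0 ^ 2 + v 1 ^ 2 < π ^ 2}

/-- `Ω_{-,4}`. -/
def OmegaMinus : Set E2 :=
  {v | v 1 < 0 ∧ π < v 0 ∧ v 0 < ‖v‖ ∧ ‖v‖ < vartheta1 ∧ K3 v < 0}

/-- `ℝ²_{>,+}`. -/
def R2Gt : Set E2 := {u | 2 / √π * √(u 0) < u 1 ∧ 0 < 2 / √π * √(u 0)}

/-- `ℝ²_{<,+}`. -/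
def R2Lt : Set E2 := {u | 0 < u 0 ∧ 0 < u 1 ∧ u 1 < 2 / √π * √(u 0)}

/-- `f` restricts to a real-analytic diffeomorphism from the open set `A` onto the open set `B`:
a bijection which is real-analytic and has a real-analytic inverse. -/
structure IsAnalyticDiffeoOn (f : E2 → E2) (A B : Set E2) : Prop where
  isOpen_source : IsOpen A
  isOpen_target : IsOpen B
  bijOn : BijOn f A B
  analytic : AnalyticOnNhd ℝ f A
  analytic_inv : AnalyticOnNhd ℝ (Function.invFunOn f A) B

/-- The Hessian matrix `(∂ᵢ ∂ⱼ f (x))` of a function on `ℝⁿ`. -/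
def hessian {n : ℕ} (f : EuclideanSpace ℝ (Fin n) → ℝ) (x : EuclideanSpace ℝ (Fin n)) :
    Matrix (Fin n) (Fin n) ℝ :=
  Matrix.of fun i j =>
    fderiv ℝ (fderiv ℝ f) x (EuclideanSpace.single i 1) (EuclideanSpace.single j 1)

/-- `w ↦ (w, 0)` from the plane to the 3-space. -/
def embed (w : E2) : E3 := !₂[w 0, w 1, 0]

/-- `g_u = (e₁, u / 4)` with `u = (ũ, 0)`. -/
def gOf (u : E2) : N32 := (EuclideanSpace.single 0 1, (4 : ℝ)⁻¹ • embed u)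

/-- `θ = (Λ⁻¹(ũ), 0)`, where `Λ⁻¹` is the inverse of the restriction of `Λ` to `A`. -/
def thetaOf (A : Set E2) (u : E2) : E3 := embed (Function.invFunOn Lam A u)

end FreeCarnot

end

open Filter Topology
open scoped ContDiff

namespace FreeCarnot


/-! Write y = |v|², q = v₂² and S_m(y) = ∑_{k ≥ 1} (k²π² - y)⁻ᵐ, so that S_m' = m S_{m+1}. The
partial fractions of the cotangent give ψ(r) = 2 S₁(r²), hence Λ = (4 v₁ q S₂, 4 v₂ (S₁ + q S₂)) and
K₃ = 4 (S₁ + q S₂). Everything reduces to inequalities between S₁, S₂, S₃: below π² all terms are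
positive, while between π² and 4π² only the k = 1 term changes sign in odd powers.

Since φ(g_u; τ) = 1 - (|τ|² - τ₁²) ψ(|τ|) + u·τ, its Hessian at a point (v, 0) is minus a block
matrix with blocks DΛ(v) and K₃(v). On `OmegaPlus` the Cauchy–Schwarz inequality S₂² ≤ S₁S₃ makes
both blocks positive. On `OmegaMinus`, det DΛ < 0 (`detFactor_neg`) and K₃ < 0, so the Hessian of φ
has negative determinant and a positive diagonal entry, which forces signature (2, 1).

In both cases DΛ is invertible, so Λ is locally an analytic diffeomorphism with open image. The
target is connected, so surjectivity follows once the image is relatively closed in it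
(`isAnalyticDiffeoOn_Lam`). By compactness this is a study of limits of Λ at the boundary of the
domain: the only delicate point is (π, 0), where every finite limit lies on the parabola π u₂² = 4
u₁ separating the targets (`tendsto_Lam_pole`).

Injectivity on `OmegaPlus` is strict convexity of v₂² ψ(|v|) on a convex set. On `OmegaMinus` it is
a Rolle argument. Each circle |v| = r meets a level set of Λ₁ at most once. If two points of
different norms had the same image, then between them the level set, cut to an annulus, would be
compact and Λ₂ would have an extremum on it away from the end circles, contradicting openness of Λ
(`not_norm_lt_of_Lam_eq`). -/

/-! ### The series `∑ₖ 1 / (k²π² - y)ᵐ` -/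

/-- The coefficient `k²π² - y` with `k = n + 2`. -/
noncomputable def tailDen (y : ℝ) (n : ℕ) : ℝ := ((n : ℝ) + 2) ^ 2 * π ^ 2 - y

/-- `∑_{k ≥ 2} 1 / (k²π² - y)ᵐ`. -/
noncomputable def tailSum (m : ℕ) (y : ℝ) : ℝ := ∑' n : ℕ, ((tailDen y n)⁻¹) ^ m

/-- `∑_{k ≥ 1} 1 / (k²π² - y)ᵐ`. -/
noncomputable def poleSum (m : ℕ) (y : ℝ) : ℝ := ((π ^ 2 - y)⁻¹) ^ m + tailSum m y

theorem tailDen_pos {y : ℝ} (hy : y < 4 * π ^ 2) (n : ℕ) : 0 < tailDen y n := by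
  unfold tailDen
  have : (0 : ℝ) ≤ n := n.cast_nonneg
  nlinarith [pi_pos, sq_nonneg π, mul_nonneg this (sq_nonneg π),
    mul_nonneg (mul_nonneg this this) (sq_nonneg π)]

theorem tailDen_zero (y : ℝ) : tailDen y 0 = 4 * π ^ 2 - y := by
  unfold tailDen; norm_num

theorem summable_tailDen_inv {y : ℝ} (hy : y < 4 * π ^ 2) :
    Summable fun n => (tailDen y n)⁻¹ := by
  have h0 : 0 < 4 * π ^ 2 - y := by linarith
  have hs : Summable fun n : ℕ => (((n : ℝ) + 1) ^ 2)⁻¹ := by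
    have := (summable_nat_add_iff (f := fun n : ℕ => ((n : ℝ) ^ 2)⁻¹) 1).2
      (Real.summable_nat_pow_inv.2 (by norm_num))
    simpa using this
  -- This constant gives c (n + 1)² ≤ `tailDen y n`, a comparison with ∑ 1 / n².
  set c := min (4 * π ^ 2 - y) (π ^ 2) with hc
  have hcpos : 0 < c := lt_min h0 (by positivity)
  refine Summable.of_nonneg_of_le (fun n => (inv_pos.2 (tailDen_pos hy n)).le) (fun n => ?_)
    (hs.mul_left c⁻¹)
  rw [← mul_inv]
  apply inv_anti₀ (by positivity)
  have h1 : c ≤ 4 * π ^ 2 - y := min_le_left _ _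
  have h2 : c ≤ π ^ 2 := min_le_right _ _
  have hn : (0 : ℝ) ≤ n := n.cast_nonneg
  have h3 : tailDen y n = (4 * π ^ 2 - y) + ((n : ℝ) ^ 2 + 4 * n) * π ^ 2 := by
    unfold tailDen; ring
  rw [h3]
  nlinarith [mul_le_mul_of_nonneg_right h2 (by positivity : 0 ≤ (n : ℝ) ^ 2 + 4 * n),
    mul_nonneg hn hcpos.le]

theorem summable_tailDen_inv_pow {y : ℝ} (hy : y < 4 * π ^ 2) (m : ℕ) :
    Summable fun n => ((tailDen y n)⁻¹) ^ (m + 1) := by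
  set a := (4 * π ^ 2 - y)⁻¹ with ha
  have h0 : 0 < 4 * π ^ 2 - y := by linarith
  refine Summable.of_nonneg_of_le (fun n => pow_nonneg (inv_pos.2 (tailDen_pos hy n)).le _)
    (fun n => ?_) ((summable_tailDen_inv hy).mul_left (a ^ m))
  rw [pow_succ]
  have hp := inv_pos.2 (tailDen_pos hy n)
  refine mul_le_mul_of_nonneg_right (pow_le_pow_left₀ hp.le ?_ m) hp.le
  apply inv_anti₀ h0
  rw [← tailDen_zero]
  unfold tailDen
  have hn : (0 : ℝ) ≤ n := n.cast_nonneg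
  gcongr
  simp

theorem tailSum_pos {y : ℝ} (hy : y < 4 * π ^ 2) (m : ℕ) : 0 < tailSum (m + 1) y :=
  (summable_tailDen_inv_pow hy m).tsum_pos
    (fun n => pow_nonneg (inv_pos.2 (tailDen_pos hy n)).le _) 0
    (pow_pos (inv_pos.2 (tailDen_pos hy 0)) _)

theorem inv_pow_le_tailSum {y : ℝ} (hy : y < 4 * π ^ 2) (m n : ℕ) :
    ((tailDen y n)⁻¹) ^ (m + 1) ≤ tailSum (m + 1) y :=
  (summable_tailDen_inv_pow hy m).le_tsum n
    (fun k _ => pow_nonneg (inv_pos.2 (tailDen_pos hy k)).le _)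

theorem hasDerivAt_tailSum {y : ℝ} (hy : y < 4 * π ^ 2) (m : ℕ) :
    HasDerivAt (tailSum (m + 1)) ((m + 1) * tailSum (m + 2) y) y := by
  -- The terms increase with y, so on z < Y their derivatives are dominated by the values at Y.
  obtain ⟨Y, hyY, hY⟩ := exists_between hy
  have key := hasDerivAt_tsum_of_isPreconnected (t := Iio Y) (y := y) (y₀ := y)
    (g := fun n z => ((tailDen z n)⁻¹) ^ (m + 1))
    (g' := fun n z => ((m : ℝ) + 1) * ((tailDen z n)⁻¹) ^ (m + 2))
    (u := fun n => ((m : ℝ) + 1) * ((tailDen Y n)⁻¹) ^ (m + 2))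
    ((summable_tailDen_inv_pow hY (m + 1)).mul_left _) isOpen_Iio isPreconnected_Iio
    ?_ ?_ hyY (summable_tailDen_inv_pow hy m) hyY
  · rw [tsum_mul_left] at key
    exact key
  · intro n z hz
    have hz' : z < 4 * π ^ 2 := lt_trans hz hY
    have hp := tailDen_pos hz' n
    have h1 : HasDerivAt (fun z => tailDen z n) (-1) z := by
      simpa [tailDen] using (hasDerivAt_id z).const_sub (((n : ℝ) + 2) ^ 2 * π ^ 2)
    have h2 := (h1.inv hp.ne').pow (m + 1)
    refine h2.congr_deriv ?_
    simp only [Pi.inv_apply, Nat.add_sub_cancel]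
    push_cast
    rw [neg_neg, one_div, ← inv_pow]
    ring
  · intro n z hz
    have hz' : z < 4 * π ^ 2 := lt_trans hz hY
    have hp := tailDen_pos hz' n
    have hp' := tailDen_pos hY n
    rw [Real.norm_of_nonneg (by positivity)]
    have : tailDen Y n ≤ tailDen z n := by
      unfold tailDen; have : z < Y := hz; linarith
    gcongr

theorem hasDerivAt_poleSum {y : ℝ} (hy : y < 4 * π ^ 2) (hy' : y ≠ π ^ 2) (m : ℕ) :
    HasDerivAt (poleSum (m + 1)) ((m + 1) * poleSum (m + 2) y) y := by
  have hne : π ^ 2 - y ≠ 0 := sub_ne_zero.2 hy'.symm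
  have h1 : HasDerivAt (fun z => π ^ 2 - z) (-1) y := by
    simpa using (hasDerivAt_id y).const_sub (π ^ 2)
  have h2 := ((h1.inv hne).pow (m + 1)).add (hasDerivAt_tailSum hy m)
  refine h2.congr_deriv ?_
  simp only [Pi.inv_apply, Nat.add_sub_cancel, poleSum]
  push_cast
  rw [neg_neg, one_div, ← inv_pow]
  ring

/-- The partial fraction expansion of the cotangent, in terms of `psi`. -/
theorem psi_eq_poleSum {r : ℝ} (h0 : 0 < r) (h2 : r < 2 * π) (h1 : r ≠ π) :
    psi r = 2 * poleSum 1 (r ^ 2) := by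
  have hpi := pi_pos
  have hy : r ^ 2 < 4 * π ^ 2 := by nlinarith
  have hmem : ((r / π : ℝ) : ℂ) ∈ Complex.integerComplement := by
    rw [Complex.mem_integerComplement_iff]
    rintro ⟨n, hn⟩
    have hn' : (n : ℝ) = r / π := by exact_mod_cast hn
    have ha : (0 : ℝ) < n := by rw [hn']; positivity
    have hb : (n : ℝ) < 2 := by rw [hn', div_lt_iff₀ hpi]; exact h2
    have ha' : 0 < n := by exact_mod_cast ha
    have hb' : n < 2 := by exact_mod_cast hb
    have : n = 1 := by omega
    subst this
    rw [eq_div_iff hpi.ne'] at hn'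
    apply h1; rw [← hn']; simp
  have hrep := cot_series_rep' hmem
  have hsum := summable_tailDen_inv_pow hy 0
  have hrr : (π : ℝ) * (r / π) = r := by field_simp
  have e1 : (π : ℂ) * Complex.cot (π * ((r / π : ℝ) : ℂ)) - 1 / ((r / π : ℝ) : ℂ)
      = ((π * Real.cot r - 1 / (r / π) : ℝ) : ℂ) := by
    rw [← Complex.ofReal_mul, hrr]
    push_cast [Complex.ofReal_cot]
    rfl
  rw [e1] at hrep
  have e2 : ∀ n : ℕ, (1 / (((r / π : ℝ) : ℂ) - (n + 1)) + 1 / (((r / π : ℝ) : ℂ) + (n + 1)))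
      = (((1 / (r / π - (n + 1)) + 1 / (r / π + (n + 1))) : ℝ) : ℂ) := by
    intro n; push_cast; rfl
  simp_rw [e2] at hrep
  rw [← Complex.ofReal_tsum] at hrep
  have hrep' := Complex.ofReal_injective hrep
  -- Index n of the cotangent series is the pole k = n + 1. The tail starts at k = 2, hence the
  -- shift; index 0 is treated separately in `e6`.
  have e3 : ∀ n : ℕ, 1 / (r / π - ((n + 1 : ℕ) + 1)) + 1 / (r / π + ((n + 1 : ℕ) + 1))
      = (-2 * π * r) * ((tailDen (r ^ 2) n)⁻¹) ^ 1 := by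
    intro n
    have hp := tailDen_pos hy n
    have hn : (0 : ℝ) ≤ n := n.cast_nonneg
    have hd : r - ((n : ℝ) + 2) * π < 0 := by nlinarith [mul_nonneg hn hpi.le]
    have hd2 : 0 < r + ((n : ℝ) + 2) * π := by positivity
    have hfac : tailDen (r ^ 2) n = -(r - ((n : ℝ) + 2) * π) * (r + ((n : ℝ) + 2) * π) := by
      unfold tailDen; ring
    have e4 : r / π - (((n + 1 : ℕ) : ℝ) + 1) = (r - ((n : ℝ) + 2) * π) / π := by
      push_cast; field_simp; ring
    have e5 : r / π + (((n + 1 : ℕ) : ℝ) + 1) = (r + ((n : ℝ) + 2) * π) / π := by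
      push_cast; field_simp; ring
    rw [e4, e5, hfac]
    have := hd.ne
    have := hd2.ne'
    field_simp
    ring
  have hs1 : Summable fun n : ℕ => 1 / (r / π - (n + 1)) + 1 / (r / π + (n + 1)) := by
    rw [← summable_nat_add_iff 1]
    simp_rw [e3]
    exact hsum.mul_left _
  rw [hs1.tsum_eq_zero_add] at hrep'
  simp_rw [e3] at hrep'
  rw [tsum_mul_left] at hrep'
  have hd1 : r - π ≠ 0 := sub_ne_zero.2 h1
  have hd2 : 0 < r + π := by positivity
  have hd3 : π ^ 2 - r ^ 2 ≠ 0 := by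
    have : π ^ 2 - r ^ 2 = -(r - π) * (r + π) := by ring
    rw [this]; exact mul_ne_zero (neg_ne_zero.2 hd1) hd2.ne'
  have e6 : 1 / (r / π - ((0 : ℕ) + 1)) + 1 / (r / π + ((0 : ℕ) + 1))
      = (-2 * π * r) * (π ^ 2 - r ^ 2)⁻¹ := by
    have e4 : r / π - (((0 : ℕ) : ℝ) + 1) = (r - π) / π := by
      push_cast; field_simp; ring
    have e5 : r / π + (((0 : ℕ) : ℝ) + 1) = (r + π) / π := by
      push_cast; field_simp; ring
    have : π ^ 2 - r ^ 2 = -(r - π) * (r + π) := by ring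
    rw [e4, e5, this]
    field_simp
    ring
  rw [e6] at hrep'
  have hfin : poleSum 1 (r ^ 2) = (π ^ 2 - r ^ 2)⁻¹ + ∑' n, ((tailDen (r ^ 2) n)⁻¹) ^ 1 := by
    simp [poleSum, tailSum]
  have h7 : π * Real.cot r - 1 / (r / π) = (-2 * π * r) * poleSum 1 (r ^ 2) := by
    rw [hfin, hrep']; ring
  have h8 : r * Real.cot r - 1 = -2 * r ^ 2 * poleSum 1 (r ^ 2) := by
    have : π * (r * Real.cot r - 1) = π * (-2 * r ^ 2 * poleSum 1 (r ^ 2)) := by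
      calc π * (r * Real.cot r - 1) = r * (π * Real.cot r - 1 / (r / π)) := by field_simp
        _ = _ := by rw [h7]; ring
    exact mul_left_cancel₀ hpi.ne' this
  rw [psi, if_neg h0.ne', div_eq_iff (by positivity)]
  linarith


/-! ### Inequalities between the pole sums below `π²` -/

theorem tailSum_le_mul {y M : ℝ} (hy : y < 4 * π ^ 2) (m : ℕ) (j : ℕ)
    (hM : ∀ n, ((tailDen y n)⁻¹) ^ j ≤ M) :
    tailSum (m + 1 + j) y ≤ M * tailSum (m + 1) y := by
  unfold tailSum
  rw [← tsum_mul_left]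
  have hs := summable_tailDen_inv_pow hy (m + j)
  rw [show m + j + 1 = m + 1 + j by ring] at hs
  refine hs.tsum_le_tsum (fun n => ?_) ((summable_tailDen_inv_pow hy m).mul_left M)
  rw [pow_add, mul_comm]
  exact mul_le_mul_of_nonneg_right (hM n) (pow_nonneg (inv_pos.2 (tailDen_pos hy n)).le _)

theorem poleSum_pos {y : ℝ} (hy : y < π ^ 2) (m : ℕ) : 0 < poleSum (m + 1) y := by
  have h1 : 0 < π ^ 2 - y := by linarith
  have h2 := tailSum_pos (y := y) (by nlinarith [pi_pos, sq_nonneg π]) m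
  unfold poleSum
  positivity

/-- Cauchy–Schwarz: with a_k = 1 / (k²π² - y) > 0, the quadratic S₁ - 2 l S₂ + l² S₃ = ∑ a_k (1 - l
a_k)² is nonnegative, and l = S₂ / S₃ minimizes it. -/
theorem poleSum_two_sq_le {y : ℝ} (hy : y < π ^ 2) :
    poleSum 2 y ^ 2 ≤ poleSum 1 y * poleSum 3 y := by
  have hy4 : y < 4 * π ^ 2 := by nlinarith [pi_pos, sq_nonneg π]
  have key : ∀ l : ℝ, 0 ≤ poleSum 1 y - 2 * l * poleSum 2 y + l ^ 2 * poleSum 3 y := by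
    intro l
    have s1 := summable_tailDen_inv_pow hy4 0
    have s2 := (summable_tailDen_inv_pow hy4 1).mul_left (2 * l)
    have s3 := (summable_tailDen_inv_pow hy4 2).mul_left (l ^ 2)
    have e : poleSum 1 y - 2 * l * poleSum 2 y + l ^ 2 * poleSum 3 y
        = (π ^ 2 - y)⁻¹ * (1 - l * (π ^ 2 - y)⁻¹) ^ 2
          + ∑' n, (tailDen y n)⁻¹ * (1 - l * (tailDen y n)⁻¹) ^ 2 := by
      have : ∀ n, (tailDen y n)⁻¹ * (1 - l * (tailDen y n)⁻¹) ^ 2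
          = (tailDen y n)⁻¹ ^ (0 + 1) - 2 * l * (tailDen y n)⁻¹ ^ (1 + 1)
            + l ^ 2 * (tailDen y n)⁻¹ ^ (2 + 1) := fun n => by ring
      simp_rw [this]
      rw [(s1.sub s2).tsum_add s3, s1.tsum_sub s2, tsum_mul_left, tsum_mul_left]
      simp only [poleSum, tailSum]
      ring
    rw [e]
    have h1 : 0 < π ^ 2 - y := by linarith
    have h2 : 0 ≤ ∑' n, (tailDen y n)⁻¹ * (1 - l * (tailDen y n)⁻¹) ^ 2 :=
      tsum_nonneg fun n => mul_nonneg (inv_pos.2 (tailDen_pos hy4 n)).le (sq_nonneg _)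
    positivity
  have h3 := poleSum_pos hy 2
  have := key (poleSum 2 y / poleSum 3 y)
  have e : poleSum 1 y - 2 * (poleSum 2 y / poleSum 3 y) * poleSum 2 y
      + (poleSum 2 y / poleSum 3 y) ^ 2 * poleSum 3 y
      = (poleSum 1 y * poleSum 3 y - poleSum 2 y ^ 2) / poleSum 3 y := by
    field_simp
    ring
  norm_num at h3
  rw [e, le_div_iff₀ h3] at this
  linarith

/-- The square of a sum of positive terms exceeds the sum of their squares; the cross term of the
first term with the tail makes it strict. -/
theorem poleSum_two_lt_sq {y : ℝ} (hy : y < π ^ 2) : poleSum 2 y < poleSum 1 y ^ 2 := by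
  have hy4 : y < 4 * π ^ 2 := by nlinarith [pi_pos, sq_nonneg π]
  have h1 : 0 < (π ^ 2 - y)⁻¹ := inv_pos.2 (by linarith)
  have h2 := tailSum_pos hy4 0
  have h3 := tailSum_le_mul hy4 0 1 (fun n => inv_pow_le_tailSum hy4 0 n)
  norm_num at h2 h3
  simp only [poleSum]
  nlinarith [mul_pos h1 h2]

/-- The determinant of the Hessian of `v₂² ψ(|v|)` is `16 v₂² detFactor (|v|²) (v₂²)`. -/
noncomputable def detFactor (y q : ℝ) : ℝ :=
  poleSum 1 y * poleSum 2 y + 4 * (y - q) * (poleSum 1 y * poleSum 3 y - poleSum 2 y ^ 2)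
    + 5 * q * poleSum 2 y ^ 2 + 4 * q * y * poleSum 2 y * poleSum 3 y

theorem detFactor_pos {y q : ℝ} (hy : y < π ^ 2) (hq : 0 ≤ q) (hqy : q ≤ y) :
    0 < detFactor y q := by
  have h1 := poleSum_pos hy 0
  have h2 := poleSum_pos hy 1
  have h3 := poleSum_pos hy 2
  have h4 := poleSum_two_sq_le hy
  norm_num at h1 h2 h3
  have h5 : 0 ≤ y - q := by linarith
  have h6 : 0 ≤ y := by linarith
  have h7 : 0 ≤ poleSum 1 y * poleSum 3 y - poleSum 2 y ^ 2 := by linarith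
  unfold detFactor
  positivity

/-- With w = v₁ this becomes 4 Λ₁ < π Λ₂² after multiplication by 16 v₂². -/
theorem mul_sq_gt_of_lt {y q w : ℝ} (hy : y < π ^ 2) (hq : 0 ≤ q) (hw : w < π) :
    poleSum 2 y * w < π * (poleSum 1 y + q * poleSum 2 y) ^ 2 := by
  have h1 := poleSum_pos hy 0
  have h2 := poleSum_pos hy 1
  have h4 := poleSum_two_lt_sq hy
  norm_num at h1 h2
  have h5 : poleSum 1 y ^ 2 ≤ (poleSum 1 y + q * poleSum 2 y) ^ 2 := by
    gcongr
    nlinarith [mul_nonneg hq h2.le]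
  nlinarith [mul_lt_mul_of_pos_left hw h2, mul_le_mul_of_nonneg_left (h4.le.trans h5) pi_pos.le]

/-! ### Inequalities between the pole sums in `(π², 4π²)` -/

section Above

variable {y q : ℝ}

theorem poleSum_two_pos (hy : y < 4 * π ^ 2) : 0 < poleSum 2 y := by
  have h2 := tailSum_pos hy 1
  unfold poleSum
  norm_num at h2
  positivity

theorem poleSum_of_gt (m : ℕ) : poleSum m y = (-(y - π ^ 2)⁻¹) ^ m + tailSum m y := by
  rw [poleSum, ← neg_sub y, inv_neg]

/-- Put b = 1 / (y - π²) and let T_m be the tails. S₁ < 0 says T₁ < b, so each tail term is below b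
and T₃ ≤ b² T₁ < b³. -/
theorem poleSum_three_neg (h1 : π ^ 2 < y) (h4 : y < 4 * π ^ 2) (hS : poleSum 1 y < 0) :
    poleSum 3 y < 0 := by
  have hb : 0 < (y - π ^ 2)⁻¹ := inv_pos.2 (by linarith)
  rw [poleSum_of_gt] at hS ⊢
  have hT := tailSum_pos h4 0
  have hle := tailSum_le_mul h4 0 2 (M := (y - π ^ 2)⁻¹ ^ 2) (fun n => by
    have := inv_pow_le_tailSum h4 0 n
    norm_num at this hS
    have h0 := inv_pos.2 (tailDen_pos h4 n)
    exact pow_le_pow_left₀ h0.le (by linarith) 2)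
  simp only [zero_add, Nat.reduceAdd, pow_one] at hT hle hS
  nlinarith [pow_pos hb 2]

/-- Cauchy–Schwarz is reversed: in S₁S₃ - S₂² the b⁴ cancel, and T₁T₃ < b T₃ leaves only negative
terms. -/
theorem poleSum_mul_lt_sq (h1 : π ^ 2 < y) (h4 : y < 4 * π ^ 2) (hS : poleSum 1 y < 0) :
    poleSum 1 y * poleSum 3 y < poleSum 2 y ^ 2 := by
  have hb : 0 < (y - π ^ 2)⁻¹ := inv_pos.2 (by linarith)
  rw [poleSum_of_gt] at hS
  rw [poleSum_of_gt, poleSum_of_gt, poleSum_of_gt]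
  have hT1 := tailSum_pos h4 0
  have hT2 := tailSum_pos h4 1
  have hT3 := tailSum_pos h4 2
  norm_num at hT1 hT2 hT3 hS
  set b := (y - π ^ 2)⁻¹
  have e1 : tailSum 1 y * tailSum 3 y < b * tailSum 3 y :=
    mul_lt_mul_of_pos_right (by linarith) hT3
  nlinarith [mul_pos hT1 (pow_pos hb 3), mul_pos hT2 (pow_pos hb 2), sq_nonneg (tailSum 2 y)]

/-- This says that on the circle |v|² = y the zero q = -S₁ / S₂ of K₃ lies below y / 2. Of the
tails, only the k = 2 term of T₁ is needed. -/
theorem neg_two_mul_poleSum_lt (h1 : π ^ 2 < y) (h4 : y < 4 * π ^ 2) :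
    -2 * poleSum 1 y < y * poleSum 2 y := by
  have hd : 0 < y - π ^ 2 := by linarith
  have hd' : 0 < 4 * π ^ 2 - y := by linarith
  have hT2 := tailSum_pos h4 1
  have hT1 := inv_pow_le_tailSum h4 0 0
  rw [tailDen_zero] at hT1
  norm_num at hT1 hT2
  have hy : 0 < y := by nlinarith [pi_pos, sq_nonneg π]
  rw [poleSum_of_gt, poleSum_of_gt]
  have key : 0 < y * ((y - π ^ 2)⁻¹) ^ 2 - 2 * (y - π ^ 2)⁻¹ + 2 * (4 * π ^ 2 - y)⁻¹ := by
    have e : ∀ d e : ℝ, 0 < d → 0 < e → y * (d⁻¹) ^ 2 - 2 * d⁻¹ + 2 * e⁻¹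
        = (y * e - 2 * d * e + 2 * d ^ 2) / (d ^ 2 * e) := by
      intro d e hd he
      field_simp
    rw [e _ _ hd hd']
    apply div_pos _ (by positivity)
    -- Three times the numerator is (3y - 5π²)² + 5π⁴.
    nlinarith [sq_nonneg (3 * y - 5 * π ^ 2), pow_pos pi_pos 4]
  nlinarith [mul_pos hy hT2]

theorem detFactor_neg (h1 : π ^ 2 < y) (h4 : y < 4 * π ^ 2) (hS : poleSum 1 y < 0)
    (hq : 0 ≤ q) (hK : poleSum 1 y + q * poleSum 2 y < 0) : detFactor y q < 0 := by
  have h2 := poleSum_two_pos h4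
  have h3 := poleSum_three_neg h1 h4 hS
  have h5 := poleSum_mul_lt_sq h1 h4 hS
  have h6 := neg_two_mul_poleSum_lt h1 h4
  have hy : 0 < y := by nlinarith [pi_pos, sq_nonneg π]
  unfold detFactor
  set S1 := poleSum 1 y
  set S2 := poleSum 2 y
  set S3 := poleSum 3 y
  have hN : (y - q) * (S1 * S3 - S2 ^ 2) + q * S2 ^ 2 + q * y * S2 * S3 < 0 := by
    -- The bracket is affine in q; this identity interpolates it between q = 0 and q = -S₁ / S₂, and
    -- it is negative at both ends.
    have e : -S1 * ((y - q) * (S1 * S3 - S2 ^ 2) + q * S2 ^ 2 + q * y * S2 * S3)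
        = (-S1 - q * S2) * (y * (S1 * S3 - S2 ^ 2))
          + q * (S1 ^ 2 * S3 - S2 ^ 2 * (y * S2 + 2 * S1)) := by ring
    have ha : (-S1 - q * S2) * (y * (S1 * S3 - S2 ^ 2)) < 0 :=
      mul_neg_of_pos_of_neg (by linarith) (mul_neg_of_pos_of_neg hy (by linarith))
    have hb : q * (S1 ^ 2 * S3 - S2 ^ 2 * (y * S2 + 2 * S1)) ≤ 0 := by
      refine mul_nonpos_of_nonneg_of_nonpos hq ?_
      have := mul_pos (pow_pos h2 2) (show 0 < y * S2 + 2 * S1 by linarith)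
      have := mul_nonpos_of_nonneg_of_nonpos (sq_nonneg S1) h3.le
      linarith
    by_contra hcon
    push Not at hcon
    have := mul_nonneg (show 0 ≤ -S1 by linarith) hcon
    linarith
  nlinarith [mul_neg_of_pos_of_neg h2 hK]

/-- If v₁² ≤ π² then q ≥ y - π², so the double pole in q S₂ outweighs the simple pole of S₁. Thus K₃
< 0 already forces v₁² > π². -/
theorem poleSum_add_pos_of_le (h1 : π ^ 2 < y) (h4 : y < 4 * π ^ 2) (hq : y - q ≤ π ^ 2) :
    0 < poleSum 1 y + q * poleSum 2 y := by
  have hd : 0 < y - π ^ 2 := by linarith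
  have hT1 := tailSum_pos h4 0
  have hT2 := tailSum_pos h4 1
  rw [poleSum_of_gt, poleSum_of_gt]
  norm_num at hT1 hT2
  set b := (y - π ^ 2)⁻¹ with hb
  have hb0 : 0 < b := inv_pos.2 hd
  have e : (y - π ^ 2) * b = 1 := mul_inv_cancel₀ hd.ne'
  have hqb : b ≤ q * b ^ 2 := by
    have : (y - π ^ 2) * b ^ 2 ≤ q * b ^ 2 := by gcongr; linarith
    nlinarith
  have hq0 : 0 < q := by linarith
  nlinarith [mul_pos hq0 hT2]

/-- The only negative part of S₁ + q S₂ is the pole -b with b = 1 / (y - π²), so its square is below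
b² < S₂. -/
theorem mul_sq_lt_of_gt {w : ℝ} (h1 : π ^ 2 < y) (h4 : y < 4 * π ^ 2) (hq : 0 ≤ q)
    (hK : poleSum 1 y + q * poleSum 2 y < 0) (hw : π < w) :
    π * (poleSum 1 y + q * poleSum 2 y) ^ 2 < poleSum 2 y * w := by
  have hd : 0 < y - π ^ 2 := by linarith
  have h2 := poleSum_two_pos h4
  have hT1 := tailSum_pos h4 0
  have hT2 := tailSum_pos h4 1
  have hlt : (poleSum 1 y + q * poleSum 2 y) ^ 2 < poleSum 2 y := by
    have hK' : -(poleSum 1 y + q * poleSum 2 y) < (y - π ^ 2)⁻¹ := by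
      have := mul_nonneg hq h2.le
      rw [poleSum_of_gt 1]
      norm_num at hT1 ⊢
      linarith
    calc (poleSum 1 y + q * poleSum 2 y) ^ 2 = (-(poleSum 1 y + q * poleSum 2 y)) ^ 2 := by ring
      _ < ((y - π ^ 2)⁻¹) ^ 2 := by gcongr; linarith
      _ < _ := by rw [poleSum_of_gt 2]; norm_num at hT2 ⊢; linarith
  nlinarith [mul_lt_mul_of_pos_left hlt pi_pos, mul_lt_mul_of_pos_left hw h2]

end Above

/-! ### The zero of `psi` in `(π, 2π)` -/

theorem vartheta1_lt_two_pi : vartheta1 < 2 * π := by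
  have := vartheta1_spec.1.2
  linarith [pi_pos]

theorem pi_lt_vartheta1 : π < vartheta1 := vartheta1_spec.1.1

theorem sq_lt_of_lt_vartheta1 {r : ℝ} (h0 : 0 ≤ r) (h : r ≤ vartheta1) : r ^ 2 < 4 * π ^ 2 := by
  nlinarith [vartheta1_lt_two_pi, pi_pos]

theorem poleSum_one_vartheta1 : poleSum 1 (vartheta1 ^ 2) = 0 := by
  have h1 := pi_lt_vartheta1
  have h0 : 0 < vartheta1 := pi_pos.trans h1
  have hpsi := psi_eq_poleSum h0 vartheta1_lt_two_pi h1.ne'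
  have htan := vartheta1_spec.2
  have hcot : vartheta1 * Real.cot vartheta1 = 1 := by
    rw [Real.cot_eq_cos_div_sin]
    rw [Real.tan_eq_sin_div_cos] at htan
    have hc : Real.cos vartheta1 ≠ 0 := by
      intro hc; rw [hc, div_zero] at htan; exact h0.ne htan
    have hs : Real.sin vartheta1 = vartheta1 * Real.cos vartheta1 := by
      rw [div_eq_iff hc] at htan; exact htan
    rw [hs]
    have := h0.ne'
    field_simp
  rw [psi, if_neg h0.ne', hcot] at hpsi
  simp at hpsi
  exact hpsi

theorem poleSum_one_neg {y : ℝ} (h1 : π ^ 2 < y) (h2 : y < vartheta1 ^ 2) : poleSum 1 y < 0 := by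
  have hθ := sq_lt_of_lt_vartheta1 (pi_pos.trans pi_lt_vartheta1).le le_rfl
  rw [← poleSum_one_vartheta1]
  have hd : ∀ z ∈ Icc y (vartheta1 ^ 2), HasDerivAt (poleSum 1) (poleSum 2 z) z := by
    intro z hz
    simpa using hasDerivAt_poleSum (y := z) (lt_of_le_of_lt hz.2 hθ) (h1.trans_le hz.1).ne' 0
  refine strictMonoOn_of_deriv_pos (convex_Icc y (vartheta1 ^ 2))
    (fun z hz => (hd z hz).continuousAt.continuousWithinAt) (fun z hz => ?_)
    (left_mem_Icc.2 h2.le) (right_mem_Icc.2 h2.le) h2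
  rw [interior_Icc] at hz
  rw [(hd z (Ioo_subset_Icc_self hz)).deriv]
  exact poleSum_two_pos (hz.2.trans hθ)

/-- Up to the factor `16`, the square of the first component of `Lam` on the curve `K3 = 0`, as a
function of `|v|²`. -/
noncomputable def boundaryVal (y : ℝ) : ℝ := poleSum 1 y ^ 2 * (y + poleSum 1 y / poleSum 2 y)

/-- The derivative is 2 S₁ (y S₂ + 2 S₁) - 2 S₁² (S₁S₃) / S₂². Both terms are negative because S₁,
S₃ < 0 and -2 S₁ < y S₂. -/
theorem strictAntiOn_boundaryVal : StrictAntiOn boundaryVal (Ioo (π ^ 2) (vartheta1 ^ 2)) := by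
  have hθ := sq_lt_of_lt_vartheta1 (pi_pos.trans pi_lt_vartheta1).le le_rfl
  have hd : ∀ z ∈ Ioo (π ^ 2) (vartheta1 ^ 2), HasDerivAt boundaryVal
      (2 * poleSum 1 z * (z * poleSum 2 z + 2 * poleSum 1 z)
        - 2 * poleSum 1 z ^ 2 * (poleSum 1 z * poleSum 3 z) / poleSum 2 z ^ 2) z := by
    intro z hz
    have h2 := poleSum_two_pos (hz.2.trans hθ)
    have d1 := hasDerivAt_poleSum (y := z) (hz.2.trans hθ) hz.1.ne' 0
    have d2 := hasDerivAt_poleSum (y := z) (hz.2.trans hθ) hz.1.ne' 1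
    have := (d1.pow 2).mul ((hasDerivAt_id z).add (d1.div d2 h2.ne'))
    refine this.congr_deriv ?_
    norm_num
    field_simp
    ring
  refine strictAntiOn_of_deriv_neg (convex_Ioo _ _)
    (fun z hz => (hd z hz).continuousAt.continuousWithinAt) (fun z hz => ?_)
  rw [interior_Ioo] at hz
  rw [(hd z hz).deriv]
  have h4 := hz.2.trans hθ
  have h1 := poleSum_one_neg hz.1 hz.2
  have h2 := poleSum_two_pos h4
  have h3 := poleSum_three_neg hz.1 h4 h1
  have h6 := neg_two_mul_poleSum_lt hz.1 h4
  have ha : 2 * poleSum 1 z * (z * poleSum 2 z + 2 * poleSum 1 z) < 0 :=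
    mul_neg_of_neg_of_pos (by linarith) (by linarith)
  have hb : 0 < 2 * poleSum 1 z ^ 2 * (poleSum 1 z * poleSum 3 z) / poleSum 2 z ^ 2 := by
    have := mul_pos_of_neg_of_neg h1 h3
    have := pow_pos (neg_pos.2 h1) 2
    rw [neg_sq] at this
    positivity
  linarith


/-! ### Smoothness of `psi` and its derivative -/

theorem contDiffAt_psi {r : ℝ} (h0 : 0 < r) (h2 : r < 2 * π) (h1 : r ≠ π) :
    ContDiffAt ℝ ω psi r := by
  have hs : Real.sin r ≠ 0 := by
    rcases lt_or_gt_of_ne h1 with h | h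
    · exact (Real.sin_pos_of_pos_of_lt_pi h0 h).ne'
    · have := Real.sin_pos_of_pos_of_lt_pi (x := r - π) (by linarith) (by linarith)
      rw [Real.sin_sub_pi] at this
      linarith
  have he : psi =ᶠ[𝓝 r] fun x => (1 - x * (Real.cos x / Real.sin x)) / x ^ 2 := by
    filter_upwards [lt_mem_nhds h0] with x hx
    rw [psi, if_neg (ne_of_gt hx), Real.cot_eq_cos_div_sin]
  refine ContDiffAt.congr_of_eventuallyEq ?_ he
  exact (contDiffAt_const.sub (contDiffAt_id.mul
    (Real.contDiff_cos.contDiffAt.div Real.contDiff_sin.contDiffAt hs))).div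
    (contDiffAt_id.pow 2) (pow_ne_zero 2 h0.ne')

theorem sq_ne_pi_sq {r : ℝ} (h0 : 0 < r) (h1 : r ≠ π) : r ^ 2 ≠ π ^ 2 := by
  intro h
  exact h1 ((pow_left_inj₀ h0.le pi_pos.le two_ne_zero).1 h)

theorem hasDerivAt_psi {r : ℝ} (h0 : 0 < r) (h2 : r < 2 * π) (h1 : r ≠ π) :
    HasDerivAt psi (4 * r * poleSum 2 (r ^ 2)) r := by
  have he : psi =ᶠ[𝓝 r] fun x => 2 * poleSum 1 (x ^ 2) := by
    filter_upwards [lt_mem_nhds h0, gt_mem_nhds h2, isOpen_ne.mem_nhds h1] with x hx hx2 hx1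
    exact psi_eq_poleSum hx hx2 hx1
  have hd := hasDerivAt_poleSum (y := r ^ 2) (by nlinarith) (sq_ne_pi_sq h0 h1) 0
  refine HasDerivAt.congr_of_eventuallyEq ?_ he
  have hsq : HasDerivAt (fun x : ℝ => x ^ 2) (2 * r) r := by
    simpa using hasDerivAt_pow 2 r
  refine ((HasDerivAt.comp (h := fun x : ℝ => x ^ 2) r hd hsq).const_mul 2).congr_deriv ?_
  norm_num
  ring

theorem deriv_psi_div {r : ℝ} (h0 : 0 < r) (h2 : r < 2 * π) (h1 : r ≠ π) :
    deriv psi r / r = 4 * poleSum 2 (r ^ 2) := by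
  rw [(hasDerivAt_psi h0 h2 h1).deriv]
  field_simp

/-! ### The function `(|τ|² - τ₁²) ψ(|τ|)` in any dimension -/

variable {n : ℕ}

/-- The region where `psi ‖τ‖` is smooth. -/
def shell (n : ℕ) : Set (EuclideanSpace ℝ (Fin (n + 1))) :=
  {τ | 0 < ‖τ‖ ∧ ‖τ‖ < 2 * π ∧ ‖τ‖ ≠ π}

theorem isOpen_shell : IsOpen (shell n) :=
  (isOpen_lt continuous_const continuous_norm).inter
    ((isOpen_lt continuous_norm continuous_const).inter
      (isOpen_ne_fun continuous_norm continuous_const))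

/-- `(|τ|² - τ₁²) ψ(|τ|)`. -/
noncomputable def potential (τ : EuclideanSpace ℝ (Fin (n + 1))) : ℝ :=
  (‖τ‖ ^ 2 - τ 0 ^ 2) * psi ‖τ‖

/-- The indicator of the coordinates different from the first. -/
def offFirst (j : Fin (n + 1)) : ℝ := if j = 0 then 0 else 1

/-- The partial derivatives of `potential`. -/
noncomputable def potentialGrad (j : Fin (n + 1)) (τ : EuclideanSpace ℝ (Fin (n + 1))) : ℝ :=
  4 * τ j * ((‖τ‖ ^ 2 - τ 0 ^ 2) * poleSum 2 (‖τ‖ ^ 2) + offFirst j * poleSum 1 (‖τ‖ ^ 2))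

/-- The second partial derivatives of `potential`. -/
noncomputable def potentialHess (i j : Fin (n + 1)) (τ : EuclideanSpace ℝ (Fin (n + 1))) : ℝ :=
  (if i = j then
    4 * ((‖τ‖ ^ 2 - τ 0 ^ 2) * poleSum 2 (‖τ‖ ^ 2) + offFirst j * poleSum 1 (‖τ‖ ^ 2)) else 0)
  + 8 * τ i * τ j * ((offFirst i + offFirst j) * poleSum 2 (‖τ‖ ^ 2)
    + 2 * (‖τ‖ ^ 2 - τ 0 ^ 2) * poleSum 3 (‖τ‖ ^ 2))

theorem inner_single_one {m : ℕ} (x : EuclideanSpace ℝ (Fin m)) (i : Fin m) :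
    inner ℝ x (EuclideanSpace.single i (1 : ℝ)) = x i := by
  rw [EuclideanSpace.inner_single_right]
  simp

variable {τ : EuclideanSpace ℝ (Fin (n + 1))}

theorem contDiffAt_potential (hτ : τ ∈ shell n) : ContDiffAt ℝ ω potential τ := by
  obtain ⟨h0, h2, h1⟩ := hτ
  have hn : ContDiffAt ℝ ω (fun τ : EuclideanSpace ℝ (Fin (n + 1)) => ‖τ‖) τ :=
    contDiffAt_norm ℝ (norm_pos_iff.1 h0)
  have hc : ContDiffAt ℝ ω (fun τ : EuclideanSpace ℝ (Fin (n + 1)) => τ 0) τ :=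
    (EuclideanSpace.proj (𝕜 := ℝ) (0 : Fin (n + 1))).contDiff.contDiffAt
  exact ((hn.pow 2).sub (hc.pow 2)).mul ((contDiffAt_psi h0 h2 h1).comp τ hn)

theorem hasFDerivAt_poleSum_norm_sq (m : ℕ) (h2 : ‖τ‖ < 2 * π) (h1 : ‖τ‖ ≠ π) :
    HasFDerivAt (fun τ => poleSum (m + 1) (‖τ‖ ^ 2))
      ((2 * ((m + 1) * poleSum (m + 2) (‖τ‖ ^ 2))) • innerSL ℝ τ) τ := by
  have hne : ‖τ‖ ^ 2 ≠ π ^ 2 := fun h =>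
    h1 ((pow_left_inj₀ (norm_nonneg _) pi_pos.le two_ne_zero).1 h)
  have hd := hasDerivAt_poleSum (y := ‖τ‖ ^ 2)
    (by nlinarith [norm_nonneg τ, pi_pos]) hne m
  refine (hd.comp_hasFDerivAt τ (hasStrictFDerivAt_norm_sq τ).hasFDerivAt).congr_fderiv ?_
  ext w
  simp
  ring

theorem hasFDerivAt_offNorm (τ : EuclideanSpace ℝ (Fin (n + 1))) :
    HasFDerivAt (fun τ : EuclideanSpace ℝ (Fin (n + 1)) => ‖τ‖ ^ 2 - τ 0 ^ 2)
      ((2 : ℝ) • innerSL ℝ τ - (2 * τ 0) • EuclideanSpace.proj (𝕜 := ℝ) (0 : Fin (n + 1))) τ := by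
  have hp : HasFDerivAt (fun τ : EuclideanSpace ℝ (Fin (n + 1)) => τ 0)
      (EuclideanSpace.proj (𝕜 := ℝ) (0 : Fin (n + 1))) τ :=
    (EuclideanSpace.proj (𝕜 := ℝ) (0 : Fin (n + 1))).hasFDerivAt
  refine ((hasStrictFDerivAt_norm_sq τ).hasFDerivAt.sub (hp.pow 2)).congr_fderiv ?_
  ext w
  simp

theorem fderiv_potential (hτ : τ ∈ shell n) (j : Fin (n + 1)) :
    fderiv ℝ potential τ (EuclideanSpace.single j 1) = potentialGrad j τ := by
  have he : potential =ᶠ[𝓝 τ]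
      fun τ : EuclideanSpace ℝ (Fin (n + 1)) => (‖τ‖ ^ 2 - τ 0 ^ 2) * (2 * poleSum 1 (‖τ‖ ^ 2)) := by
    filter_upwards [isOpen_shell.mem_nhds hτ] with x hx
    rw [potential, psi_eq_poleSum hx.1 hx.2.1 hx.2.2]
  have hd := (hasFDerivAt_offNorm τ).mul
    ((hasFDerivAt_poleSum_norm_sq 0 hτ.2.1 hτ.2.2).const_mul 2)
  have hd' := hd.congr_of_eventuallyEq (f₁ := potential) he
  rw [hd'.fderiv]
  rcases eq_or_ne j 0 with rfl | hj
  · simp [potentialGrad, offFirst, inner_single_one]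
    ring
  · simp [potentialGrad, offFirst, inner_single_one, hj, hj.symm]
    ring

theorem hasFDerivAt_potentialGrad (h2 : ‖τ‖ < 2 * π) (h1 : ‖τ‖ ≠ π) (j : Fin (n + 1)) :
    ∃ L : EuclideanSpace ℝ (Fin (n + 1)) →L[ℝ] ℝ, HasFDerivAt (potentialGrad j) L τ ∧
      ∀ i, L (EuclideanSpace.single i 1) = potentialHess i j τ := by
  have hp : HasFDerivAt (fun τ : EuclideanSpace ℝ (Fin (n + 1)) => τ j)
      (EuclideanSpace.proj (𝕜 := ℝ) j) τ := (EuclideanSpace.proj (𝕜 := ℝ) j).hasFDerivAt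
  have hd := (hp.const_mul 4).mul
    (((hasFDerivAt_offNorm τ).mul (hasFDerivAt_poleSum_norm_sq 1 h2 h1)).add
      ((hasFDerivAt_poleSum_norm_sq 0 h2 h1).const_mul (offFirst j)))
  refine ⟨_, hd, fun i => ?_⟩
  rcases eq_or_ne i j with rfl | hij
  · rcases eq_or_ne i 0 with rfl | hi
    · simp [potentialHess, offFirst, inner_single_one]
      ring
    · simp [potentialHess, offFirst, inner_single_one, hi, hi.symm]
      ring
  · rcases eq_or_ne i 0 with rfl | hi
    · simp [potentialHess, offFirst, inner_single_one, hij, hij.symm]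
      ring
    · rcases eq_or_ne j 0 with rfl | hj
      · simp [potentialHess, offFirst, inner_single_one, hi, hi.symm]
        ring
      · simp [potentialHess, offFirst, inner_single_one, hij, hij.symm, hi, hi.symm, hj]
        ring

/-- The origin is included, since the pole sums are smooth there. Limits of `Lam` along sequences
tending to 0 therefore need no separate case. -/
theorem continuousAt_potentialGrad (h2 : ‖τ‖ < 2 * π) (h1 : ‖τ‖ ≠ π) (j : Fin (n + 1)) :
    ContinuousAt (potentialGrad j) τ :=
  (hasFDerivAt_potentialGrad h2 h1 j).choose_spec.1.continuousAt

theorem hessian_eq_of_eventually {m : ℕ} {f : EuclideanSpace ℝ (Fin m) → ℝ}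
    {x : EuclideanSpace ℝ (Fin m)} (hf : ContDiffAt ℝ 2 f x)
    {G : Fin m → EuclideanSpace ℝ (Fin m) → ℝ}
    (hG : ∀ j, ∀ᶠ y in 𝓝 x, fderiv ℝ f y (EuclideanSpace.single j 1) = G j y) (i j : Fin m) :
    hessian f x i j = fderiv ℝ (G j) x (EuclideanSpace.single i 1) := by
  have hd : DifferentiableAt ℝ (fderiv ℝ f) x :=
    (hf.fderiv_right (m := 1) (by norm_num)).differentiableAt one_ne_zero
  have he : (fun y => fderiv ℝ f y (EuclideanSpace.single j 1)) =ᶠ[𝓝 x] G j := hG j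
  rw [← he.fderiv_eq, fderiv_clm_apply hd (differentiableAt_const _)]
  simp [hessian]

theorem potentialHess_symm (i j : Fin (n + 1)) (τ : EuclideanSpace ℝ (Fin (n + 1))) :
    potentialHess i j τ = potentialHess j i τ := by
  rcases eq_or_ne i j with rfl | h
  · rfl
  · simp only [potentialHess, if_neg h, if_neg h.symm]
    ring

/-! ### The reference function -/

theorem phi_gOf (u : E2) (τ : E3) : phi (gOf u) τ = 1 - potential τ + inner ℝ (embed u) τ := by
  have h1 : inner ℝ τ (EuclideanSpace.single 0 1 : E3) = τ 0 :=
    inner_single_one τ 0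
  simp only [phi, gOf, potential, h1, real_inner_smul_left, PiLp.norm_single]
  norm_num
  ring

theorem contDiffAt_phi (u : E2) {τ : E3} (hτ : τ ∈ shell 2) :
    ContDiffAt ℝ 2 (phi (gOf u)) τ := by
  rw [show phi (gOf u) = fun τ => 1 - potential τ + inner ℝ (embed u) τ from
    funext (phi_gOf u)]
  have := (contDiffAt_potential hτ).of_le (m := 2) le_top
  exact (contDiffAt_const.sub this).add (innerSL ℝ (embed u)).contDiff.contDiffAt

theorem fderiv_phi (u : E2) {τ : E3} (hτ : τ ∈ shell 2) (j : Fin 3) :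
    fderiv ℝ (phi (gOf u)) τ (EuclideanSpace.single j 1) = -potentialGrad j τ + embed u j := by
  rw [show phi (gOf u) = fun τ => 1 - potential τ + inner ℝ (embed u) τ from
    funext (phi_gOf u)]
  have hd := ((contDiffAt_potential hτ).differentiableAt (by simp)).hasFDerivAt
  have := (hd.const_sub 1).add (innerSL ℝ (embed u)).hasFDerivAt
  erw [HasFDerivAt.fderiv this]
  rw [add_apply, neg_apply, fderiv_potential hτ j]
  simp [inner_single_one]

theorem hessian_phi (u : E2) {τ : E3} (hτ : τ ∈ shell 2) (i j : Fin 3) :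
    hessian (phi (gOf u)) τ i j = -potentialHess i j τ := by
  rw [hessian_eq_of_eventually (contDiffAt_phi u hτ)
    (G := fun j τ => -potentialGrad j τ + embed u j) (fun j => by
      filter_upwards [isOpen_shell.mem_nhds hτ] with y hy
      exact fderiv_phi u hy j)]
  obtain ⟨L, hL, hLi⟩ := hasFDerivAt_potentialGrad hτ.2.1 hτ.2.2 j
  have hd : HasFDerivAt (fun τ => -potentialGrad j τ + embed u j) (-L) τ :=
    hL.neg.add_const _
  rw [hd.fderiv, neg_apply, hLi]

theorem hessian_neg_phi (u : E2) {τ : E3} (hτ : τ ∈ shell 2) (i j : Fin 3) :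
    hessian (fun τ => -phi (gOf u) τ) τ i j = potentialHess i j τ := by
  rw [← neg_neg (potentialHess i j τ), ← hessian_phi u hτ]
  simp only [hessian, Matrix.of_apply]
  have : fderiv ℝ (fun τ => -phi (gOf u) τ) = -fderiv ℝ (phi (gOf u)) := by
    ext1 x
    simp [fderiv_fun_neg]
  rw [this, fderiv_neg]
  rfl

/-! ### The map `Lam` -/

theorem norm_sq_eq (v : E2) : ‖v‖ ^ 2 = v 0 ^ 2 + v 1 ^ 2 := by
  rw [EuclideanSpace.norm_sq_eq]
  simp [Fin.sum_univ_two]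

theorem Lam_apply {v : E2} (hv : v ∈ shell 1) (j : Fin 2) : Lam v j = potentialGrad j v := by
  have h := norm_sq_eq v
  simp only [Lam, deriv_psi_div hv.1 hv.2.1 hv.2.2, psi_eq_poleSum hv.1 hv.2.1 hv.2.2,
    potentialGrad, h]
  fin_cases j
  · simp [offFirst]; ring
  · simp [offFirst]; ring

theorem K3_eq {v : E2} (hv : v ∈ shell 1) :
    K3 v = 4 * (poleSum 1 (‖v‖ ^ 2) + v 1 ^ 2 * poleSum 2 (‖v‖ ^ 2)) := by
  rw [K3, deriv_psi_div hv.1 hv.2.1 hv.2.2, psi_eq_poleSum hv.1 hv.2.1 hv.2.2]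
  ring

theorem Lam_zero {v : E2} (hv : v ∈ shell 1) :
    Lam v 0 = 4 * v 0 * v 1 ^ 2 * poleSum 2 (‖v‖ ^ 2) := by
  rw [Lam_apply hv, potentialGrad, norm_sq_eq]
  simp [offFirst]; ring

theorem Lam_one {v : E2} (hv : v ∈ shell 1) :
    Lam v 1 = 4 * v 1 * (poleSum 1 (‖v‖ ^ 2) + v 1 ^ 2 * poleSum 2 (‖v‖ ^ 2)) := by
  rw [Lam_apply hv, potentialGrad, norm_sq_eq]
  simp only [offFirst, one_ne_zero, if_false]; ring

theorem clm_apply_eq_sum {m : ℕ} (L : EuclideanSpace ℝ (Fin m) →L[ℝ] ℝ)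
    (w : EuclideanSpace ℝ (Fin m)) : L w = ∑ i, w i * L (EuclideanSpace.single i 1) := by
  conv_lhs => rw [← (EuclideanSpace.basisFun (Fin m) ℝ).sum_repr w]
  simp [map_sum]

theorem hasGradientAt_Lam {v : E2} (hv : v ∈ shell 1) :
    HasGradientAt (fun w : E2 => w 1 ^ 2 * psi ‖w‖) (Lam v) v := by
  have he : (fun w : E2 => w 1 ^ 2 * psi ‖w‖) = potential := by
    ext w
    rw [potential, norm_sq_eq]
    ring
  rw [he, hasGradientAt_iff_hasFDerivAt]
  refine ((contDiffAt_potential hv).differentiableAt (by simp)).hasFDerivAt.congr_fderiv ?_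
  ext w
  rw [clm_apply_eq_sum]
  simp only [fderiv_potential hv, ← Lam_apply hv, InnerProductSpace.toDual_apply_apply,
    PiLp.inner_apply]
  simp

theorem analyticAt_Lam {v : E2} (hv : v ∈ shell 1) : AnalyticAt ℝ Lam v := by
  have h1 : ContDiffAt ℝ ω (fderiv ℝ (potential (n := 1))) v :=
    (contDiffAt_potential hv).fderiv_right (m := ω) le_top
  have h2 : ContDiffAt ℝ ω Lam v := by
    rw [contDiffAt_euclidean]
    intro j
    have he : (fun w => Lam w j) =ᶠ[𝓝 v]
        fun w => fderiv ℝ (potential (n := 1)) w (EuclideanSpace.single j 1) := by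
      filter_upwards [isOpen_shell.mem_nhds hv] with w hw
      rw [Lam_apply hw, fderiv_potential hw]
    exact (h1.clm_apply contDiffAt_const).congr_of_eventuallyEq he
  exact h2.analyticAt

theorem fderiv_Lam_apply {v : E2} (hv : v ∈ shell 1) (w : E2) (j : Fin 2) :
    fderiv ℝ Lam v w j = w 0 * potentialHess 0 j v + w 1 * potentialHess 1 j v := by
  have hd := (analyticAt_Lam hv).hasStrictFDerivAt
  have hj := (hasStrictFDerivAt_euclidean.1 hd j).hasFDerivAt
  obtain ⟨L, hL, hLi⟩ := hasFDerivAt_potentialGrad hv.2.1 hv.2.2 j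
  have he : (fun w => Lam w j) =ᶠ[𝓝 v] potentialGrad j := by
    filter_upwards [isOpen_shell.mem_nhds hv] with w hw
    exact Lam_apply hw j
  have := hj.unique (hL.congr_of_eventuallyEq he)
  have h3 := congrArg (fun M : E2 →L[ℝ] ℝ => M w) this
  rw [clm_apply_eq_sum L w, Fin.sum_univ_two, hLi, hLi] at h3
  exact h3


/-! ### The Hessian on the two domains -/

theorem potentialHess_det (v : E2) :
    potentialHess 0 0 v * potentialHess 1 1 v - potentialHess 0 1 v * potentialHess 1 0 v
      = 16 * v 1 ^ 2 * detFactor (‖v‖ ^ 2) (v 1 ^ 2) := by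
  have h := norm_sq_eq v
  simp only [potentialHess, detFactor, offFirst, if_true, if_false, one_ne_zero, zero_ne_one]
  generalize poleSum 1 (‖v‖ ^ 2) = S1
  generalize poleSum 2 (‖v‖ ^ 2) = S2
  generalize poleSum 3 (‖v‖ ^ 2) = S3
  rw [h]
  ring

/-! ### Block form of the three-dimensional Hessian over the plane -/

theorem embed_norm (v : E2) : ‖embed v‖ = ‖v‖ := by
  rw [EuclideanSpace.norm_eq, EuclideanSpace.norm_eq]
  simp [embed, Fin.sum_univ_three, Fin.sum_univ_two]

theorem embed_mem_shell {v : E2} (hv : v ∈ shell 1) : embed v ∈ shell 2 := by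
  have h := embed_norm v
  exact ⟨h.symm ▸ hv.1, h.symm ▸ hv.2.1, fun h' => hv.2.2 (h.symm.trans h')⟩

theorem potentialHess_embed (v : E2) (i j : Fin 2) :
    potentialHess (n := 2) i.castSucc j.castSucc (embed v) = potentialHess i j v := by
  fin_cases i <;> fin_cases j <;> simp [potentialHess, embed_norm, offFirst] <;> simp [embed]

theorem potentialHess_embed_two (v : E2) (j : Fin 2) :
    potentialHess (n := 2) 2 j.castSucc (embed v) = 0 := by
  fin_cases j <;> simp [potentialHess, embed]

theorem potentialHess_embed_two_two (v : E2) :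
    potentialHess (n := 2) 2 2 (embed v)
      = 4 * (poleSum 1 (‖v‖ ^ 2) + v 1 ^ 2 * poleSum 2 (‖v‖ ^ 2)) := by
  have h : ‖v‖ ^ 2 - v 0 ^ 2 = v 1 ^ 2 := by rw [norm_sq_eq]; ring
  have h0 : embed v 0 = v 0 := rfl
  have h2 : embed v 2 = 0 := rfl
  have hn : norm (E := EuclideanSpace ℝ (Fin (2 + 1))) (embed v) = ‖v‖ := embed_norm v
  simp only [potentialHess, hn, offFirst, h0, h2, h]
  norm_num [Fin.ext_iff]
  ring

/-! ### Definiteness on `OmegaPlus` and signature on `OmegaMinus` -/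

theorem mem_shell_of_mem_OmegaPlus {v : E2} (hv : v ∈ OmegaPlus) :
    v ∈ shell 1 ∧ ‖v‖ ^ 2 < π ^ 2 := by
  obtain ⟨h0, h1, h2⟩ := hv
  rw [← norm_sq_eq] at h2
  have h3 : ‖v‖ < π := lt_of_pow_lt_pow_left₀ 2 pi_pos.le h2
  refine ⟨⟨norm_pos_iff.2 ?_, by linarith [pi_pos], h3.ne⟩, h2⟩
  rintro rfl
  simp at h0

theorem mem_shell_of_mem_OmegaMinus {v : E2} (hv : v ∈ OmegaMinus) :
    v ∈ shell 1 ∧ π ^ 2 < ‖v‖ ^ 2 ∧ ‖v‖ ^ 2 < vartheta1 ^ 2 ∧ ‖v‖ ^ 2 < 4 * π ^ 2 := by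
  obtain ⟨h0, h1, h2, h3, -⟩ := hv
  have hp := pi_pos
  have := vartheta1_lt_two_pi
  exact ⟨⟨by linarith, by linarith, by linarith⟩, by nlinarith, by nlinarith, by nlinarith⟩

theorem OmegaMinus_K3 {v : E2} (hv : v ∈ OmegaMinus) :
    poleSum 1 (‖v‖ ^ 2) + v 1 ^ 2 * poleSum 2 (‖v‖ ^ 2) < 0 := by
  have h := hv.2.2.2.2
  rw [K3_eq (mem_shell_of_mem_OmegaMinus hv).1] at h
  linarith

theorem potentialHess_zero_zero_pos {v : E2} (hv : v ∈ OmegaPlus) :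
    0 < potentialHess 0 0 v := by
  have hy := (mem_shell_of_mem_OmegaPlus hv).2
  have h2 := poleSum_pos hy 1
  have h3 := poleSum_pos hy 2
  norm_num at h2 h3
  have h : ‖v‖ ^ 2 - v 0 ^ 2 = v 1 ^ 2 := by rw [norm_sq_eq]; ring
  simp only [potentialHess, offFirst, if_true, h]
  have h0 := hv.1
  have h1 := hv.2.1
  have e : 4 * (v 1 ^ 2 * poleSum 2 (‖v‖ ^ 2) + 0 * poleSum 1 (‖v‖ ^ 2))
      + 8 * v 0 * v 0 * ((0 + 0) * poleSum 2 (‖v‖ ^ 2) + 2 * v 1 ^ 2 * poleSum 3 (‖v‖ ^ 2))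
      = 4 * v 1 ^ 2 * poleSum 2 (‖v‖ ^ 2) + 16 * v 0 ^ 2 * v 1 ^ 2 * poleSum 3 (‖v‖ ^ 2) := by
    ring
  rw [e]
  positivity

theorem potentialHess_det_pos {v : E2} (hv : v ∈ OmegaPlus) :
    0 < potentialHess 0 0 v * potentialHess 1 1 v - potentialHess 0 1 v * potentialHess 1 0 v := by
  rw [potentialHess_det]
  have := detFactor_pos (mem_shell_of_mem_OmegaPlus hv).2 (sq_nonneg (v 1))
    (by rw [norm_sq_eq]; nlinarith [sq_nonneg (v 0)])
  have := hv.2.1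
  positivity

theorem potentialHess_det_neg {v : E2} (hv : v ∈ OmegaMinus) :
    potentialHess 0 0 v * potentialHess 1 1 v - potentialHess 0 1 v * potentialHess 1 0 v < 0 := by
  obtain ⟨-, h1, h2, h4⟩ := mem_shell_of_mem_OmegaMinus hv
  rw [potentialHess_det]
  have := detFactor_neg h1 h4 (poleSum_one_neg h1 h2) (sq_nonneg (v 1)) (OmegaMinus_K3 hv)
  refine mul_neg_of_pos_of_neg ?_ this
  have := sq_pos_of_neg hv.1
  linarith

theorem quadratic_pos {a b c x y : ℝ} (ha : 0 < a) (hdet : 0 < a * c - b * b)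
    (hxy : x ≠ 0 ∨ y ≠ 0) : 0 < a * x ^ 2 + 2 * b * x * y + c * y ^ 2 := by
  have e : a * (a * x ^ 2 + 2 * b * x * y + c * y ^ 2)
      = (a * x + b * y) ^ 2 + (a * c - b * b) * y ^ 2 := by ring
  have : 0 < a * (a * x ^ 2 + 2 * b * x * y + c * y ^ 2) := by
    rw [e]
    rcases eq_or_ne y 0 with rfl | hy
    · have hx : x ≠ 0 := by simpa using hxy
      have : 0 < (a * x) ^ 2 := by positivity
      simpa using this
    · have : 0 < y ^ 2 := by positivity
      nlinarith [sq_nonneg (a * x + b * y), mul_pos hdet this]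
  exact pos_of_mul_pos_right this ha.le

theorem potentialHess_quadratic_pos {v : E2} (hv : v ∈ OmegaPlus) {x y : ℝ}
    (hxy : x ≠ 0 ∨ y ≠ 0) :
    0 < potentialHess 0 0 v * x ^ 2 + 2 * potentialHess 0 1 v * x * y
      + potentialHess 1 1 v * y ^ 2 := by
  have h := potentialHess_det_pos hv
  rw [potentialHess_symm 1 0] at h
  exact quadratic_pos (potentialHess_zero_zero_pos hv) h hxy

theorem hessian_neg_phi_posDef (u : E2) {v : E2} (hv : v ∈ OmegaPlus) :
    (hessian (fun τ => -phi (gOf u) τ) (embed v)).PosDef := by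
  obtain ⟨hs, hy⟩ := mem_shell_of_mem_OmegaPlus hv
  have hH := hessian_neg_phi u (embed_mem_shell hs)
  have h22 : 0 < potentialHess (n := 2) 2 2 (embed v) := by
    rw [potentialHess_embed_two_two]
    have h1 := poleSum_pos hy 0
    have h2 := poleSum_pos hy 1
    norm_num at h1 h2
    positivity
  have e00 := potentialHess_embed v 0 0
  have e01 := potentialHess_embed v 0 1
  have e11 := potentialHess_embed v 1 1
  have e20 := potentialHess_embed_two v 0
  have e21 := potentialHess_embed_two v 1
  simp only [Fin.castSucc_zero, Fin.castSucc_one] at e00 e01 e11 e20 e21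
  refine Matrix.PosDef.of_dotProduct_mulVec_pos ?_ ?_
  · ext i j
    simp only [Matrix.conjTranspose_apply, star_trivial, hH]
    exact potentialHess_symm j i _
  · intro x hx
    have e : star x ⬝ᵥ (hessian (fun τ => -phi (gOf u) τ) (embed v)).mulVec x
        = (potentialHess 0 0 v * x 0 ^ 2 + 2 * potentialHess 0 1 v * x 0 * x 1
          + potentialHess 1 1 v * x 1 ^ 2) + potentialHess (n := 2) 2 2 (embed v) * x 2 ^ 2 := by
      simp only [dotProduct, Matrix.mulVec, Fin.sum_univ_three, hH, star_trivial]
      rw [potentialHess_symm 0 2, potentialHess_symm 1 2, potentialHess_symm 1 0, e00, e01, e11,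
        e20, e21]
      ring
    rw [e]
    by_cases h : x 0 ≠ 0 ∨ x 1 ≠ 0
    · have := potentialHess_quadratic_pos hv h
      positivity
    · push Not at h
      have h2 : x 2 ≠ 0 := by
        intro h2
        apply hx
        ext i
        fin_cases i <;> simp [h.1, h.2, h2]
      simp only [h.1, h.2]
      have : 0 < x 2 ^ 2 := by positivity
      simp only [ne_eq, OfNat.ofNat_ne_zero, not_false_eq_true, zero_pow, mul_zero, add_zero,
        zero_add]
      positivity

/-- A negative determinant means one or three negative eigenvalues and none zero; the positive
diagonal entry, a combination of the eigenvalues with weights U_ik² ≥ 0, rules out three. -/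
theorem card_pos_eigenvalues_eq_two {H : Matrix (Fin 3) (Fin 3) ℝ} (hH : H.IsHermitian)
    (hdet : H.det < 0) {i : Fin 3} (hi : 0 < H i i) :
    (Finset.univ.filter fun i : Fin 3 => 0 < hH.eigenvalues i).card = 2 := by
  have hd : H.det = hH.eigenvalues 0 * hH.eigenvalues 1 * hH.eigenvalues 2 := by
    rw [hH.det_eq_prod_eigenvalues]
    simp [Fin.prod_univ_three]
  rw [hd] at hdet
  have hex : ∃ k, 0 < hH.eigenvalues k := by
    by_contra hcon
    push Not at hcon
    have hdiag : H i i = ∑ k, hH.eigenvalues k * (hH.eigenvectorUnitary : Matrix _ _ ℝ) i k ^ 2 := by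
      conv_lhs => rw [hH.spectral_theorem]
      simp only [Unitary.conjStarAlgAut_apply, Matrix.mul_apply, Matrix.diagonal_apply,
        Matrix.star_apply]
      simp
      refine Finset.sum_congr rfl fun k _ => by ring
    rw [hdiag] at hi
    exact hi.not_ge (Finset.sum_nonpos fun k _ =>
      mul_nonpos_of_nonpos_of_nonneg (hcon k) (sq_nonneg _))
  rw [Finset.card_filter, Fin.sum_univ_three]
  have hex' : 0 < hH.eigenvalues 0 ∨ 0 < hH.eigenvalues 1 ∨ 0 < hH.eigenvalues 2 := by
    simpa [Fin.exists_fin_succ] using hex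
  clear hex hd
  generalize hH.eigenvalues 0 = a at *
  generalize hH.eigenvalues 1 = b at *
  generalize hH.eigenvalues 2 = c at *
  have ha : a ≠ 0 := by rintro rfl; simp at hdet
  have hb : b ≠ 0 := by rintro rfl; simp at hdet
  have hc : c ≠ 0 := by rintro rfl; simp at hdet
  rcases lt_or_gt_of_ne ha with ha | ha <;> rcases lt_or_gt_of_ne hb with hb | hb <;>
    rcases lt_or_gt_of_ne hc with hc | hc
  · exact absurd hex' (by simp [ha.le, hb.le, hc.le])
  · exact absurd hdet (mul_pos (mul_pos_of_neg_of_neg ha hb) hc).not_gt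
  · exact absurd hdet (mul_pos_of_neg_of_neg (mul_neg_of_neg_of_pos ha hb) hc).not_gt
  · simp [ha.le.not_gt, hb, hc]
  · exact absurd hdet (mul_pos_of_neg_of_neg (mul_neg_of_pos_of_neg ha hb) hc).not_gt
  · simp [ha, hb.le.not_gt, hc]
  · simp [ha, hb, hc.le.not_gt]
  · exact absurd hdet (mul_pos (mul_pos ha hb) hc).not_gt

theorem hessian_phi_isHermitian (u : E2) {v : E2} (hv : v ∈ shell 1) :
    (hessian (phi (gOf u)) (embed v)).IsHermitian := by
  ext i j
  simp only [Matrix.conjTranspose_apply, star_trivial, hessian_phi u (embed_mem_shell hv)]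
  rw [potentialHess_symm]

theorem hessian_phi_det_neg (u : E2) {v : E2} (hv : v ∈ OmegaMinus) :
    (hessian (phi (gOf u)) (embed v)).det < 0 := by
  have hs := (mem_shell_of_mem_OmegaMinus hv).1
  have hH := hessian_phi u (embed_mem_shell hs)
  have h22 : potentialHess (n := 2) 2 2 (embed v) < 0 := by
    rw [potentialHess_embed_two_two]
    linarith [OmegaMinus_K3 hv]
  have e00 := potentialHess_embed v 0 0
  have e01 := potentialHess_embed v 0 1
  have e10 := potentialHess_embed v 1 0
  have e11 := potentialHess_embed v 1 1
  have e20 := potentialHess_embed_two v 0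
  have e21 := potentialHess_embed_two v 1
  simp only [Fin.castSucc_zero, Fin.castSucc_one] at e00 e01 e10 e11 e20 e21
  have e : (hessian (phi (gOf u)) (embed v)).det
      = -((potentialHess 0 0 v * potentialHess 1 1 v - potentialHess 0 1 v * potentialHess 1 0 v)
        * potentialHess (n := 2) 2 2 (embed v)) := by
    rw [Matrix.det_fin_three]
    simp only [hH]
    rw [potentialHess_symm 0 2, potentialHess_symm 1 2, e00, e01, e10, e11, e20, e21]
    ring
  rw [e]
  have := mul_pos_of_neg_of_neg (potentialHess_det_neg hv) h22
  linarith

theorem hessian_phi_two_two_pos (u : E2) {v : E2} (hv : v ∈ OmegaMinus) :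
    0 < hessian (phi (gOf u)) (embed v) 2 2 := by
  rw [hessian_phi u (embed_mem_shell (mem_shell_of_mem_OmegaMinus hv).1),
    potentialHess_embed_two_two]
  linarith [OmegaMinus_K3 hv]


/-! ### A criterion for `Lam` to be an analytic diffeomorphism -/

theorem exists_equiv_fderiv_Lam {v : E2} (hv : v ∈ shell 1)
    (hdet : potentialHess 0 0 v * potentialHess 1 1 v
      - potentialHess 0 1 v * potentialHess 1 0 v ≠ 0) :
    ∃ e : E2 ≃L[ℝ] E2, (e : E2 →L[ℝ] E2) = fderiv ℝ Lam v := by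
  have hinj : Function.Injective (fderiv ℝ Lam v).toLinearMap := by
    rw [← LinearMap.ker_eq_bot, LinearMap.ker_eq_bot']
    intro w hw
    have h0 := congrArg (fun x : E2 => x 0) hw
    have h1 := congrArg (fun x : E2 => x 1) hw
    simp only [ContinuousLinearMap.coe_coe, fderiv_Lam_apply hv, PiLp.zero_apply] at h0 h1
    have e0 : w 0 * (potentialHess 0 0 v * potentialHess 1 1 v
      - potentialHess 0 1 v * potentialHess 1 0 v) = 0 := by
      linear_combination potentialHess 1 1 v * h0 - potentialHess 1 0 v * h1
    have e1 : w 1 * (potentialHess 0 0 v * potentialHess 1 1 v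
      - potentialHess 0 1 v * potentialHess 1 0 v) = 0 := by
      linear_combination potentialHess 0 0 v * h1 - potentialHess 0 1 v * h0
    ext i
    fin_cases i
    · exact (mul_eq_zero.1 e0).resolve_right hdet
    · exact (mul_eq_zero.1 e1).resolve_right hdet
  refine ⟨(LinearEquiv.ofInjectiveEndo _ hinj).toContinuousLinearEquiv, ?_⟩
  ext w : 1
  rfl

theorem exists_analytic_local_inverse {f : E2 → E2} {x : E2} (hf : AnalyticAt ℝ f x)
    {e : E2 ≃L[ℝ] E2} (he : (e : E2 →L[ℝ] E2) = fderiv ℝ f x) :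
    ∃ g : E2 → E2, AnalyticAt ℝ g (f x) ∧ g (f x) = x ∧ ∀ᶠ y in 𝓝 (f x), f (g y) = y := by
  have hs : HasStrictFDerivAt f (e : E2 →L[ℝ] E2) x := he ▸ hf.hasStrictFDerivAt
  let R := hs.toOpenPartialHomeomorph f
  have hx : x ∈ R.source := hs.mem_toOpenPartialHomeomorph_source
  refine ⟨R.symm, ?_, R.left_inv hx, ?_⟩
  · exact R.analyticAt_symm' hx hf he.symm
  · exact R.eventually_right_inverse' hx

theorem map_nhds_Lam {v : E2} (hv : v ∈ shell 1)
    (hdet : potentialHess 0 0 v * potentialHess 1 1 v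
      - potentialHess 0 1 v * potentialHess 1 0 v ≠ 0) :
    map Lam (𝓝 v) = 𝓝 (Lam v) := by
  obtain ⟨e, he⟩ := exists_equiv_fderiv_Lam hv hdet
  have hs : HasStrictFDerivAt Lam (e : E2 →L[ℝ] E2) v :=
    he ▸ (analyticAt_Lam hv).hasStrictFDerivAt
  exact hs.map_nhds_eq_of_equiv

/-- Open–closed argument: the image is open by local inversion and relatively closed in the
connected set B by `hcl`, so it fills B. -/
theorem isAnalyticDiffeoOn_Lam {A B : Set E2} (hA : IsOpen A) (hB : IsOpen B)
    (hAs : A ⊆ shell 1)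
    (hdet : ∀ v ∈ A, potentialHess 0 0 v * potentialHess 1 1 v
      - potentialHess 0 1 v * potentialHess 1 0 v ≠ 0)
    (hne : A.Nonempty) (hmaps : MapsTo Lam A B) (hinj : InjOn Lam A) (hBc : IsPreconnected B)
    (hcl : closure (Lam '' A) ∩ B ⊆ Lam '' A) : IsAnalyticDiffeoOn Lam A B := by
  have hopen : IsOpen (Lam '' A) := by
    rw [isOpen_iff_mem_nhds]
    rintro _ ⟨v, hv, rfl⟩
    rw [← map_nhds_Lam (hAs hv) (hdet v hv)]
    exact image_mem_map (hA.mem_nhds hv)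
  have hsurj : SurjOn Lam A B := by
    refine hBc.subset_of_closure_inter_subset hopen ?_ hcl
    obtain ⟨v, hv⟩ := hne
    exact ⟨Lam v, hmaps hv, mem_image_of_mem _ hv⟩
  refine ⟨hA, hB, ⟨hmaps, hinj, hsurj⟩, fun v hv => analyticAt_Lam (hAs hv), ?_⟩
  intro u hu
  obtain ⟨v, hv, rfl⟩ := hsurj hu
  obtain ⟨e, he⟩ := exists_equiv_fderiv_Lam (hAs hv) (hdet v hv)
  obtain ⟨g, hg, hgv, hfg⟩ := exists_analytic_local_inverse (analyticAt_Lam (hAs hv)) he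
  refine hg.congr ?_
  -- Near `Lam v` the local inverse stays in A, so injectivity identifies it with the global
  -- inverse, which inherits its analyticity.
  have hgA : ∀ᶠ y in 𝓝 (Lam v), g y ∈ A :=
    hg.continuousAt.eventually_mem (by rw [hgv]; exact hA.mem_nhds hv)
  filter_upwards [hgA, hfg] with y hy hy'
  have hmem : y ∈ Lam '' A := ⟨g y, hy, hy'⟩
  exact hinj hy (Function.invFunOn_mem hmem) (hy'.trans (Function.invFunOn_eq hmem).symm)

/-! ### The domains and the targets -/

theorem continuous_coord (i : Fin 2) : Continuous fun v : E2 => v i :=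
  (EuclideanSpace.proj (𝕜 := ℝ) i).continuous

theorem isOpen_OmegaPlus : IsOpen OmegaPlus := by
  have c0 := continuous_coord 0
  have c1 := continuous_coord 1
  exact (isOpen_lt continuous_const c0).inter ((isOpen_lt continuous_const c1).inter
    (isOpen_lt ((c0.pow 2).add (c1.pow 2)) continuous_const))

theorem continuousAt_poleSum_norm_sq (m : ℕ) {v : E2} (h2 : ‖v‖ < 2 * π) (h1 : ‖v‖ ≠ π) :
    ContinuousAt (fun v : E2 => poleSum (m + 1) (‖v‖ ^ 2)) v :=
  (hasFDerivAt_poleSum_norm_sq (n := 1) (τ := v) m h2 h1).continuousAt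

theorem isOpen_OmegaMinus : IsOpen OmegaMinus := by
  have c0 := continuous_coord 0
  have c1 := continuous_coord 1
  have hU : IsOpen {v : E2 | v 1 < 0 ∧ π < v 0 ∧ v 0 < ‖v‖ ∧ ‖v‖ < vartheta1} :=
    (isOpen_lt c1 continuous_const).inter ((isOpen_lt continuous_const c0).inter
      ((isOpen_lt c0 continuous_norm).inter (isOpen_lt continuous_norm continuous_const)))
  have hs : ∀ v ∈ {v : E2 | v 1 < 0 ∧ π < v 0 ∧ v 0 < ‖v‖ ∧ ‖v‖ < vartheta1}, v ∈ shell 1 := by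
    rintro v ⟨-, h1, h2, h3⟩
    have := pi_pos
    have := vartheta1_lt_two_pi
    exact ⟨by linarith, by linarith, by linarith⟩
  have hc : ContinuousOn (fun v : E2 => 4 * (poleSum 1 (‖v‖ ^ 2) + v 1 ^ 2 * poleSum 2 (‖v‖ ^ 2)))
      {v : E2 | v 1 < 0 ∧ π < v 0 ∧ v 0 < ‖v‖ ∧ ‖v‖ < vartheta1} := by
    intro v hv
    obtain ⟨-, h2, h1⟩ := hs v hv
    exact (continuousAt_const.mul ((continuousAt_poleSum_norm_sq 0 h2 h1).add
      ((c1.pow 2).continuousAt.mul (continuousAt_poleSum_norm_sq 1 h2 h1)))).continuousWithinAt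
  have hK := hc.isOpen_inter_preimage hU isOpen_Iio (t := Iio 0)
  convert hK using 1
  ext v
  constructor
  · rintro ⟨h1, h2, h3, h4, h5⟩
    refine ⟨⟨h1, h2, h3, h4⟩, ?_⟩
    rwa [K3_eq (hs v ⟨h1, h2, h3, h4⟩)] at h5
  · rintro ⟨hv, h5⟩
    refine ⟨hv.1, hv.2.1, hv.2.2.1, hv.2.2.2, ?_⟩
    rw [K3_eq (hs v hv)]
    exact h5

theorem continuous_sqrt_coord : Continuous fun u : E2 => 2 / √π * √(u 0) :=
  continuous_const.mul (Real.continuous_sqrt.comp (continuous_coord 0))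

theorem isOpen_R2Gt : IsOpen R2Gt :=
  (isOpen_lt continuous_sqrt_coord (continuous_coord 1)).inter
    (isOpen_lt continuous_const continuous_sqrt_coord)

theorem isOpen_R2Lt : IsOpen R2Lt :=
  (isOpen_lt continuous_const (continuous_coord 0)).inter
    ((isOpen_lt continuous_const (continuous_coord 1)).inter
      (isOpen_lt (continuous_coord 1) continuous_sqrt_coord))

theorem two_div_sqrt_pi_pos : 0 < 2 / √π := by positivity

theorem sq_two_div_sqrt_pi_mul {x : ℝ} (hx : 0 ≤ x) : (2 / √π * √x) ^ 2 = 4 * x / π := by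
  rw [mul_pow, div_pow, Real.sq_sqrt pi_pos.le, Real.sq_sqrt hx]
  ring

theorem mem_R2Gt_iff {u : E2} : u ∈ R2Gt ↔ 0 < u 0 ∧ 0 < u 1 ∧ 4 * u 0 < π * u 1 ^ 2 := by
  have hc := two_div_sqrt_pi_pos
  have hpi := pi_pos
  constructor
  · rintro ⟨h1, h2⟩
    have h0 : 0 < u 0 := Real.sqrt_pos.1 (pos_of_mul_pos_right h2 hc.le)
    refine ⟨h0, h2.trans h1, ?_⟩
    have := pow_lt_pow_left₀ h1 h2.le two_ne_zero
    rw [sq_two_div_sqrt_pi_mul h0.le, div_lt_iff₀ hpi] at this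
    linarith
  · rintro ⟨h0, h1, h2⟩
    refine ⟨lt_of_pow_lt_pow_left₀ 2 h1.le ?_, mul_pos hc (Real.sqrt_pos.2 h0)⟩
    rw [sq_two_div_sqrt_pi_mul h0.le, div_lt_iff₀ hpi]
    linarith

theorem mem_R2Lt_iff {u : E2} : u ∈ R2Lt ↔ 0 < u 0 ∧ 0 < u 1 ∧ π * u 1 ^ 2 < 4 * u 0 := by
  have hc := two_div_sqrt_pi_pos
  have hpi := pi_pos
  refine and_congr_right fun h0 => and_congr_right fun h1 => ?_
  rw [← pow_lt_pow_iff_left₀ h1.le (by positivity) two_ne_zero, sq_two_div_sqrt_pi_mul h0.le,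
    lt_div_iff₀ hpi, mul_comm]

theorem continuous_toLp_pair {X : Type*} [TopologicalSpace X] {f g : X → ℝ} (hf : Continuous f)
    (hg : Continuous g) : Continuous fun x => (!₂[f x, g x] : E2) := by
  refine (PiLp.continuous_toLp 2 _).comp (continuous_pi fun i => ?_)
  fin_cases i
  · exact hf
  · exact hg

theorem isPreconnected_R2Gt : IsPreconnected R2Gt := by
  have hpc : IsPreconnected (Ioi (0 : ℝ) ×ˢ Ioi (0 : ℝ)) := isPreconnected_Ioi.prod isPreconnected_Ioi
  have hc : Continuous fun p : ℝ × ℝ => (!₂[p.1, p.2 + 2 / √π * √p.1] : E2) :=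
    continuous_toLp_pair continuous_fst
      (continuous_snd.add (continuous_const.mul (Real.continuous_sqrt.comp continuous_fst)))
  convert hpc.image _ hc.continuousOn
  ext u
  constructor
  · rintro ⟨h1, h2⟩
    have h0 : 0 < u 0 := Real.sqrt_pos.1 (pos_of_mul_pos_right h2 two_div_sqrt_pi_pos.le)
    refine ⟨(u 0, u 1 - 2 / √π * √(u 0)), ⟨h0, sub_pos.2 h1⟩, ?_⟩
    ext i
    fin_cases i <;> simp
  · rintro ⟨⟨a, b⟩, ⟨ha, hb⟩, rfl⟩
    have ha : 0 < a := ha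
    have hb : 0 < b := hb
    exact ⟨by simp [hb], mul_pos two_div_sqrt_pi_pos (Real.sqrt_pos.2 ha)⟩

theorem isPreconnected_R2Lt : IsPreconnected R2Lt := by
  have hpc : IsPreconnected (Ioi (0 : ℝ) ×ˢ Ioo (0 : ℝ) 1) := isPreconnected_Ioi.prod isPreconnected_Ioo
  have hc : Continuous fun p : ℝ × ℝ => (!₂[p.1, p.2 * (2 / √π * √p.1)] : E2) :=
    continuous_toLp_pair continuous_fst
      (continuous_snd.mul (continuous_const.mul (Real.continuous_sqrt.comp continuous_fst)))
  convert hpc.image _ hc.continuousOn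
  ext u
  constructor
  · rintro ⟨h0, h1, h2⟩
    have hpos : 0 < 2 / √π * √(u 0) := mul_pos two_div_sqrt_pi_pos (Real.sqrt_pos.2 h0)
    refine ⟨(u 0, u 1 / (2 / √π * √(u 0))), ⟨h0, by positivity, (div_lt_one hpos).2 h2⟩, ?_⟩
    ext i
    fin_cases i
    · rfl
    · exact div_mul_cancel₀ _ hpos.ne'
  · rintro ⟨⟨a, b⟩, ⟨ha, hb0, hb1⟩, rfl⟩
    have ha : 0 < a := ha
    have hb0 : 0 < b := hb0
    have hb1 : b < 1 := hb1
    have hpos : 0 < 2 / √π * √a := mul_pos two_div_sqrt_pi_pos (Real.sqrt_pos.2 ha)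
    refine ⟨ha, mul_pos hb0 hpos, ?_⟩
    show b * (2 / √π * √a) < 2 / √π * √a
    nlinarith


/-! ### Limits of `Lam` -/

theorem exists_seq_of_mem_closure_image {A : Set E2} (hA : A ⊆ shell 1) {u : E2}
    (hu : u ∈ closure (Lam '' A)) :
    ∃ (v : ℕ → E2) (w : E2), (∀ n, v n ∈ A) ∧ Tendsto v atTop (𝓝 w) ∧
      Tendsto (fun n => Lam (v n)) atTop (𝓝 u) := by
  obtain ⟨x, hx, hxu⟩ := mem_closure_iff_seq_limit.1 hu
  choose v hv hvx using hx
  obtain ⟨w, -, φ, hφ, hw⟩ := (isCompact_closedBall (0 : E2) (2 * π)).tendsto_subseq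
    (x := v) (fun n => mem_closedBall_zero_iff.2 (hA (hv n)).2.1.le)
  refine ⟨v ∘ φ, w, fun n => hv _, hw, ?_⟩
  simp only [Function.comp_apply, hvx]
  exact hxu.comp hφ.tendsto_atTop

theorem tendsto_coord {v : ℕ → E2} {w : E2} (h : Tendsto v atTop (𝓝 w)) (i : Fin 2) :
    Tendsto (fun n => v n i) atTop (𝓝 (w i)) :=
  ((continuous_coord i).tendsto w).comp h

theorem eq_potentialGrad_of_tendsto {v : ℕ → E2} {u w : E2} (hv : ∀ n, v n ∈ shell 1)
    (hw : Tendsto v atTop (𝓝 w)) (hu : Tendsto (fun n => Lam (v n)) atTop (𝓝 u))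
    (h2 : ‖w‖ < 2 * π) (h1 : ‖w‖ ≠ π) (j : Fin 2) : u j = potentialGrad j w := by
  have ha := tendsto_coord hu j
  have hb := (continuousAt_potentialGrad (n := 1) h2 h1 j).tendsto.comp hw
  refine tendsto_nhds_unique ha (hb.congr fun n => ?_)
  exact (Lam_apply (hv n) j).symm

theorem continuousAt_tailSum {y : ℝ} (hy : y < 4 * π ^ 2) (m : ℕ) :
    ContinuousAt (tailSum (m + 1)) y := (hasDerivAt_tailSum hy m).continuousAt

/-- At the point `(π, 0)` the map `Lam` can only have limits on the curve `π u₂² = 4 u₁`. -/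
theorem tendsto_Lam_pole {v : ℕ → E2} {u w : E2} (hv : ∀ n, v n ∈ shell 1)
    (hw : Tendsto v atTop (𝓝 w)) (hu : Tendsto (fun n => Lam (v n)) atTop (𝓝 u))
    (h0 : w 0 = π) (h1 : w 1 = 0) : π * u 1 ^ 2 = 4 * u 0 := by
  have hy : π ^ 2 < 4 * π ^ 2 := by nlinarith [pi_pos, sq_pos_of_pos pi_pos]
  have hn : ‖w‖ ^ 2 = π ^ 2 := by rw [norm_sq_eq, h0, h1]; ring
  have hT : ∀ m, Tendsto (fun n => tailSum (m + 1) (‖v n‖ ^ 2)) atTop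
      (𝓝 (tailSum (m + 1) (π ^ 2))) := by
    intro m
    have := (hw.norm.pow 2)
    rw [hn] at this
    exact (continuousAt_tailSum hy m).tendsto.comp this
  have hT1 := hT 0
  have hT2 := hT 1
  norm_num at hT1 hT2
  have c0 := tendsto_coord hw 0
  have c1 := tendsto_coord hw 1
  rw [h0] at c0
  rw [h1] at c1
  have u0 := tendsto_coord hu 0
  have u1 := tendsto_coord hu 1
  -- With Z = v₂ / (π² - |v|²), Λ₁ / (4 v₁) = Z² + v₂² T₂, where T₂ is the tail and v₂ → 0. So Z² →
  -- u₁ / (4π).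
  have hX : Tendsto (fun n => (v n 1 * (π ^ 2 - ‖v n‖ ^ 2)⁻¹) ^ 2) atTop (𝓝 (u 0 / (4 * π))) := by
    have hlim := ((u0.div (c0.const_mul 4) (by positivity)).sub ((c1.pow 2).mul hT2))
    simp only [ne_eq, OfNat.ofNat_ne_zero, not_false_eq_true, zero_pow, zero_mul, sub_zero] at hlim
    refine hlim.congr' ?_
    filter_upwards [c0.eventually (lt_mem_nhds pi_pos)] with n hn
    rw [Pi.div_apply, Lam_zero (hv n)]
    simp only [poleSum]
    field_simp
    ring
  -- Likewise Λ₂ / 4 = Z + v₂ (T₁ + Z² + v₂² T₂), and the bracket is bounded by the previous limit.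
  have hZ : Tendsto (fun n => v n 1 * (π ^ 2 - ‖v n‖ ^ 2)⁻¹) atTop (𝓝 (u 1 / 4)) := by
    have hlim := (u1.div_const 4).sub (c1.mul ((hT1.add hX).add ((c1.pow 2).mul hT2)))
    simp only [zero_mul, sub_zero] at hlim
    refine hlim.congr fun n => ?_
    rw [Lam_one (hv n)]
    simp only [poleSum]
    ring
  have := tendsto_nhds_unique (hZ.pow 2) hX
  rw [eq_div_iff (by positivity)] at this
  linarith

/-! ### The diffeomorphism on `OmegaPlus` -/

theorem mapsTo_OmegaPlus : MapsTo Lam OmegaPlus R2Gt := by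
  intro v hv
  obtain ⟨hs, hy⟩ := mem_shell_of_mem_OmegaPlus hv
  obtain ⟨h0, h1, h2⟩ := hv
  have p1 := poleSum_pos hy 0
  have p2 := poleSum_pos hy 1
  norm_num at p1 p2
  rw [mem_R2Gt_iff, Lam_zero hs, Lam_one hs]
  refine ⟨by positivity, by positivity, ?_⟩
  have hw : v 0 < π := lt_of_pow_lt_pow_left₀ 2 pi_pos.le (by nlinarith [sq_nonneg (v 1)])
  have key := mul_sq_gt_of_lt hy (sq_nonneg (v 1)) hw
  nlinarith [mul_lt_mul_of_pos_left key (sq_pos_of_pos h1)]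

theorem convex_OmegaPlus : Convex ℝ OmegaPlus := by
  have : OmegaPlus = {v : E2 | 0 < v 0} ∩ ({v : E2 | 0 < v 1} ∩ Metric.ball 0 π) := by
    ext v
    have : v 0 ^ 2 + v 1 ^ 2 < π ^ 2 ↔ ‖v‖ < π := by
      rw [← norm_sq_eq, pow_lt_pow_iff_left₀ (norm_nonneg _) pi_pos.le two_ne_zero]
    simp [OmegaPlus, this]
  rw [this]
  have hlin : ∀ i : Fin 2, Convex ℝ {v : E2 | 0 < v i} := fun i =>
    convex_halfSpace_gt (EuclideanSpace.proj (𝕜 := ℝ) i).toLinearMap.isLinear 0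
  exact (hlin 0).inter ((hlin 1).inter (convex_ball 0 π))

theorem injOn_OmegaPlus : InjOn Lam OmegaPlus := by
  intro v hv w hw hvw
  by_contra hne
  set d := w - v with hd
  have hd0 : d 0 ≠ 0 ∨ d 1 ≠ 0 := by
    by_contra hcon
    push Not at hcon
    apply hne
    have : d = 0 := by
      ext i
      fin_cases i
      · exact hcon.1
      · exact hcon.2
    exact (sub_eq_zero.1 this).symm
  have hmem : ∀ t ∈ Icc (0 : ℝ) 1, v + t • d ∈ OmegaPlus := fun t ht =>
    convex_OmegaPlus.add_smul_sub_mem hv hw ht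
  -- The component of Λ along d has as derivative the positive Hessian form of d, so it cannot agree
  -- at both ends of the segment.
  have hder : ∀ t ∈ Icc (0 : ℝ) 1, HasDerivAt
      (fun t : ℝ => Lam (v + t • d) 0 * d 0 + Lam (v + t • d) 1 * d 1)
      (potentialHess 0 0 (v + t • d) * d 0 ^ 2 + 2 * potentialHess 0 1 (v + t • d) * d 0 * d 1
        + potentialHess 1 1 (v + t • d) * d 1 ^ 2) t := by
    intro t ht
    have hs := (mem_shell_of_mem_OmegaPlus (hmem t ht)).1
    have hγ : HasDerivAt (fun t : ℝ => v + t • d) d t := by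
      simpa using ((hasDerivAt_id t).smul_const d).const_add v
    have hL := (analyticAt_Lam hs).differentiableAt.hasFDerivAt.comp_hasDerivAt t hγ
    have hc : ∀ i : Fin 2, HasDerivAt (fun t : ℝ => Lam (v + t • d) i)
        (fderiv ℝ Lam (v + t • d) d i) t := fun i =>
      (EuclideanSpace.proj (𝕜 := ℝ) i).hasFDerivAt.comp_hasDerivAt t hL
    refine (((hc 0).mul_const (d 0)).add ((hc 1).mul_const (d 1))).congr_deriv ?_
    rw [fderiv_Lam_apply hs, fderiv_Lam_apply hs, potentialHess_symm 1 0]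
    ring
  have hmono := strictMonoOn_of_deriv_pos (convex_Icc (0 : ℝ) 1)
    (fun t ht => (hder t ht).continuousAt.continuousWithinAt) (fun t ht => by
      have ht' := interior_subset ht
      rw [(hder t ht').deriv]
      exact potentialHess_quadratic_pos (hmem t ht') hd0)
  have := hmono (left_mem_Icc.2 zero_le_one) (right_mem_Icc.2 zero_le_one) zero_lt_one
  simp [hd, hvw] at this

theorem closure_image_OmegaPlus : closure (Lam '' OmegaPlus) ∩ R2Gt ⊆ Lam '' OmegaPlus := by
  rintro u ⟨hu, huB⟩
  rw [mem_R2Gt_iff] at huB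
  obtain ⟨hu0, hu1, hu2⟩ := huB
  have hsub : OmegaPlus ⊆ shell 1 := fun v hv => (mem_shell_of_mem_OmegaPlus hv).1
  obtain ⟨v, w, hv, hw, hlim⟩ := exists_seq_of_mem_closure_image hsub hu
  have hvs : ∀ n, v n ∈ shell 1 := fun n => hsub (hv n)
  have w0 : 0 ≤ w 0 := ge_of_tendsto' (tendsto_coord hw 0) fun n => (hv n).1.le
  have w1 : 0 ≤ w 1 := ge_of_tendsto' (tendsto_coord hw 1) fun n => (hv n).2.1.le
  have wn : ‖w‖ ≤ π := le_of_tendsto' hw.norm fun n =>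
    (lt_of_pow_lt_pow_left₀ 2 pi_pos.le (mem_shell_of_mem_OmegaPlus (hv n)).2).le
  rcases wn.lt_or_eq with hlt | heq
  · have hgrad := eq_potentialGrad_of_tendsto hvs hw hlim (by linarith [pi_pos]) hlt.ne
    have h := hgrad 0
    have e : potentialGrad 0 w = 4 * w 0 * (w 1 ^ 2 * poleSum 2 (‖w‖ ^ 2)) := by
      rw [potentialGrad, norm_sq_eq]
      simp [offFirst]
    rw [e] at h
    have hw0 : w 0 ≠ 0 := by
      intro hz; rw [hz] at h; simp at h; exact hu0.ne' h
    have hw1 : w 1 ≠ 0 := by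
      intro hz; rw [hz] at h; simp at h; exact hu0.ne' h
    have hwm : w ∈ OmegaPlus := by
      refine ⟨lt_of_le_of_ne w0 hw0.symm, lt_of_le_of_ne w1 hw1.symm, ?_⟩
      rw [← norm_sq_eq]
      exact pow_lt_pow_left₀ hlt (norm_nonneg _) two_ne_zero
    refine ⟨w, hwm, ?_⟩
    ext j
    rw [Lam_apply (hsub hwm), hgrad j]
  · exfalso
    rcases w1.eq_or_lt with h1 | h1
    · have h0 : w 0 = π := by
        have h := norm_sq_eq w
        rw [heq, ← h1] at h
        exact ((pow_left_inj₀ pi_pos.le w0 two_ne_zero).1 (by linarith)).symm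
      exact hu2.ne (tendsto_Lam_pole hvs hw hlim h0 h1.symm).symm
    -- On the circle |w| = π with w₂ > 0 the double pole makes Λ₂ blow up; since Λ₂ converges, this
    -- bound gives 4 w₂³ ≤ 0 in the limit.
    · have hbound : ∀ n, 4 * v n 1 ^ 3 ≤ Lam (v n) 1 * (π ^ 2 - ‖v n‖ ^ 2) ^ 2 := by
        intro n
        have hy := (mem_shell_of_mem_OmegaPlus (hv n)).2
        have hv1 := (hv n).2.1
        have p1 := poleSum_pos hy 0
        have p2 := tailSum_pos (y := ‖v n‖ ^ 2) (by nlinarith [pi_pos, sq_nonneg π]) 1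
        norm_num at p1 p2
        have hd : 0 < π ^ 2 - ‖v n‖ ^ 2 := by linarith
        have e : poleSum 2 (‖v n‖ ^ 2) * (π ^ 2 - ‖v n‖ ^ 2) ^ 2
            = 1 + tailSum 2 (‖v n‖ ^ 2) * (π ^ 2 - ‖v n‖ ^ 2) ^ 2 := by
          simp only [poleSum]
          field_simp
        have e2 : Lam (v n) 1 * (π ^ 2 - ‖v n‖ ^ 2) ^ 2
            = 4 * v n 1 * poleSum 1 (‖v n‖ ^ 2) * (π ^ 2 - ‖v n‖ ^ 2) ^ 2
              + 4 * v n 1 ^ 3 * (poleSum 2 (‖v n‖ ^ 2) * (π ^ 2 - ‖v n‖ ^ 2) ^ 2) := by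
          rw [Lam_one (hvs n)]; ring
        rw [e2, e, mul_add, mul_one]
        have : 0 ≤ 4 * v n 1 * poleSum 1 (‖v n‖ ^ 2) * (π ^ 2 - ‖v n‖ ^ 2) ^ 2 := by positivity
        have : 0 ≤ 4 * v n 1 ^ 3 * (tailSum 2 (‖v n‖ ^ 2) * (π ^ 2 - ‖v n‖ ^ 2) ^ 2) := by
          positivity
        linarith
      have hl := ((tendsto_coord hw 1).pow 3).const_mul 4
      have hr := (tendsto_coord hlim 1).mul ((tendsto_const_nhds (x := π ^ 2)).sub
        (hw.norm.pow 2) |>.pow 2)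
      have := le_of_tendsto_of_tendsto' hl hr hbound
      rw [heq] at this
      have h3 := pow_pos h1 3
      simp at this
      linarith

theorem nonempty_OmegaPlus : OmegaPlus.Nonempty := by
  refine ⟨!₂[1, 1], by simp, by simp, ?_⟩
  have := pi_gt_three
  simp
  nlinarith

theorem isAnalyticDiffeoOn_OmegaPlus : IsAnalyticDiffeoOn Lam OmegaPlus R2Gt :=
  isAnalyticDiffeoOn_Lam isOpen_OmegaPlus isOpen_R2Gt
    (fun _ hv => (mem_shell_of_mem_OmegaPlus hv).1) (fun _ hv => (potentialHess_det_pos hv).ne')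
    nonempty_OmegaPlus mapsTo_OmegaPlus injOn_OmegaPlus isPreconnected_R2Gt closure_image_OmegaPlus


/-! ### The diffeomorphism on `OmegaMinus` -/

theorem mapsTo_OmegaMinus : MapsTo Lam OmegaMinus R2Lt := by
  intro v hv
  obtain ⟨hs, hy1, -, hy4⟩ := mem_shell_of_mem_OmegaMinus hv
  have hK := OmegaMinus_K3 hv
  obtain ⟨h1, h0, -⟩ := hv
  have hq := sq_pos_of_neg h1
  have p2 := poleSum_two_pos hy4
  have h0' : 0 < v 0 := pi_pos.trans h0
  rw [mem_R2Lt_iff, Lam_zero hs, Lam_one hs]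
  refine ⟨by positivity, mul_pos_of_neg_of_neg (by linarith) hK, ?_⟩
  have key := mul_sq_lt_of_gt hy1 hy4 hq.le hK h0
  nlinarith [mul_lt_mul_of_pos_left key hq]

/-- Membership without π < v₁, which K₃ < 0 implies through `poleSum_add_pos_of_le`. -/
theorem mem_OmegaMinus {v : E2} (h0 : 0 ≤ v 0) (h1 : v 1 < 0) (hn : π < ‖v‖)
    (hn' : ‖v‖ < vartheta1) (hK : poleSum 1 (‖v‖ ^ 2) + v 1 ^ 2 * poleSum 2 (‖v‖ ^ 2) < 0) :
    v ∈ OmegaMinus := by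
  have hpi := pi_pos
  have hs : v ∈ shell 1 := ⟨hpi.trans hn, hn'.trans vartheta1_lt_two_pi, hn.ne'⟩
  have h := norm_sq_eq v
  refine ⟨h1, ?_, ?_, hn', ?_⟩
  · have hlt : π ^ 2 < v 0 ^ 2 := by
      by_contra hcon
      push Not at hcon
      have := poleSum_add_pos_of_le (y := ‖v‖ ^ 2) (q := v 1 ^ 2) (by gcongr)
        (sq_lt_of_lt_vartheta1 (norm_nonneg _) hn'.le) (by linarith)
      linarith
    exact lt_of_pow_lt_pow_left₀ 2 h0 hlt
  · have := sq_pos_of_neg h1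
    exact lt_of_pow_lt_pow_left₀ 2 (norm_nonneg _) (by linarith)
  · rw [K3_eq hs]
    linarith

theorem closure_image_OmegaMinus : closure (Lam '' OmegaMinus) ∩ R2Lt ⊆ Lam '' OmegaMinus := by
  rintro u ⟨hu, huB⟩
  rw [mem_R2Lt_iff] at huB
  obtain ⟨hu0, hu1, hu2⟩ := huB
  have hpi := pi_pos
  have hsub : OmegaMinus ⊆ shell 1 := fun v hv => (mem_shell_of_mem_OmegaMinus hv).1
  obtain ⟨v, w, hv, hw, hlim⟩ := exists_seq_of_mem_closure_image hsub hu
  have hvs : ∀ n, v n ∈ shell 1 := fun n => hsub (hv n)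
  have w0 : π ≤ w 0 := ge_of_tendsto' (tendsto_coord hw 0) fun n => (hv n).2.1.le
  have w1 : w 1 ≤ 0 := le_of_tendsto' (tendsto_coord hw 1) fun n => (hv n).1.le
  have wn : ‖w‖ ≤ vartheta1 := le_of_tendsto' hw.norm fun n => (hv n).2.2.2.1.le
  have wn' : π ≤ ‖w‖ := ge_of_tendsto' hw.norm fun n => ((hv n).2.1.trans (hv n).2.2.1).le
  have h := norm_sq_eq w
  rcases wn'.lt_or_eq with hlt | heq
  · have hs : w ∈ shell 1 := ⟨hpi.trans hlt, wn.trans_lt vartheta1_lt_two_pi, hlt.ne'⟩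
    have hLam : Lam w = u := by
      ext j
      rw [Lam_apply hs, eq_potentialGrad_of_tendsto hvs hw hlim hs.2.1 hs.2.2]
    have p2 := poleSum_two_pos (sq_lt_of_lt_vartheta1 (norm_nonneg _) wn)
    rw [← hLam, Lam_zero hs] at hu0
    rw [← hLam, Lam_one hs] at hu1
    have hw1 : w 1 < 0 := by
      refine lt_of_le_of_ne w1 fun hz => ?_
      rw [hz] at hu0
      simp at hu0
    have hK : poleSum 1 (‖w‖ ^ 2) + w 1 ^ 2 * poleSum 2 (‖w‖ ^ 2) < 0 := by
      by_contra hcon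
      push Not at hcon
      have := mul_nonpos_of_nonpos_of_nonneg (show 4 * w 1 ≤ 0 by linarith) hcon
      linarith
    -- On the outer circle S₁ = 0, so K₃ is positive there.
    have hne : ‖w‖ ≠ vartheta1 := by
      intro heq
      rw [heq, poleSum_one_vartheta1] at hK
      rw [heq] at p2
      have := mul_pos (sq_pos_of_neg hw1) p2
      linarith
    exact ⟨w, mem_OmegaMinus (hpi.le.trans w0) hw1 hlt (lt_of_le_of_ne wn hne) hK, hLam⟩
  · exfalso
    have h1 : w 1 = 0 := by
      rw [← heq] at h
      have : π ^ 2 ≤ w 0 ^ 2 := by gcongr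
      exact pow_eq_zero_iff two_ne_zero |>.1 (le_antisymm (by linarith) (sq_nonneg _))
    have h0 : w 0 = π := by
      rw [← heq, h1] at h
      exact ((pow_left_inj₀ hpi.le (hpi.le.trans w0) two_ne_zero).1 (by linarith)).symm
    exact hu2.ne (tendsto_Lam_pole hvs hw hlim h0 h1)

/-! #### Circular sections of `OmegaMinus` -/

/-- On a circle |v|² = y, Λ₁² is a constant times q² (y - q). This monotonicity, with -S₁ / S₂ < y /
2, makes Λ₁ injective on each circular section of `OmegaMinus`. -/
theorem sq_mul_sub_lt {y p q : ℝ} (hp : 0 ≤ p) (hpq : p < q) (hq : 2 * q ≤ y) :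
    p ^ 2 * (y - p) < q ^ 2 * (y - q) := by
  have e : q ^ 2 * (y - q) - p ^ 2 * (y - p)
      = (q - p) * ((y - q - p) * (q + p) + q * p) := by ring
  have h1 : 0 ≤ (y - q - p) * (q + p) := mul_nonneg (by linarith) (by linarith)
  have h2 : 0 < (q - p) * ((y - q - p) * (q + p) + q * p) := by
    apply mul_pos (by linarith)
    rcases hp.eq_or_lt with rfl | hp
    · have : 0 < (y - q - 0) * (q + 0) := mul_pos (by linarith) (by linarith)
      linarith
    · have := mul_pos (hp.trans hpq) hp
      linarith
  linarith

theorem Lam_zero_sq {v : E2} (hv : v ∈ shell 1) :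
    Lam v 0 ^ 2 = 16 * poleSum 2 (‖v‖ ^ 2) ^ 2 * ((v 1 ^ 2) ^ 2 * (‖v‖ ^ 2 - v 1 ^ 2)) := by
  rw [Lam_zero hv]
  have : v 0 ^ 2 = ‖v‖ ^ 2 - v 1 ^ 2 := by rw [norm_sq_eq]; ring
  rw [← this]
  ring

theorem neg_poleSum_div_bounds {y : ℝ} (h1 : π ^ 2 < y) (h2 : y < vartheta1 ^ 2) :
    0 < -poleSum 1 y / poleSum 2 y ∧ 2 * (-poleSum 1 y / poleSum 2 y) < y := by
  have h4 := h2.trans (sq_lt_of_lt_vartheta1 (pi_pos.trans pi_lt_vartheta1).le le_rfl)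
  have p2 := poleSum_two_pos h4
  refine ⟨div_pos (by linarith [poleSum_one_neg h1 h2]) p2, ?_⟩
  rw [← mul_div_assoc, div_lt_iff₀ p2]
  linarith [neg_two_mul_poleSum_lt h1 h4]

theorem sixteen_mul_boundaryVal {y : ℝ} (hy : y < 4 * π ^ 2) :
    16 * boundaryVal y = 16 * poleSum 2 y ^ 2
      * ((-poleSum 1 y / poleSum 2 y) ^ 2 * (y - -poleSum 1 y / poleSum 2 y)) := by
  have p2 := (poleSum_two_pos hy).ne'
  rw [boundaryVal]
  field_simp
  ring

theorem sq_lt_of_mem_OmegaMinus {v : E2} (hv : v ∈ OmegaMinus) :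
    v 1 ^ 2 < -poleSum 1 (‖v‖ ^ 2) / poleSum 2 (‖v‖ ^ 2) := by
  obtain ⟨-, -, -, h4⟩ := mem_shell_of_mem_OmegaMinus hv
  rw [lt_div_iff₀ (poleSum_two_pos h4)]
  linarith [OmegaMinus_K3 hv]

theorem Lam_zero_sq_lt {v : E2} (hv : v ∈ OmegaMinus) :
    Lam v 0 ^ 2 < 16 * boundaryVal (‖v‖ ^ 2) := by
  obtain ⟨hs, h1, h2, h4⟩ := mem_shell_of_mem_OmegaMinus hv
  rw [Lam_zero_sq hs, sixteen_mul_boundaryVal h4]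
  have p2 := poleSum_two_pos h4
  refine mul_lt_mul_of_pos_left ?_ (by positivity)
  exact sq_mul_sub_lt (sq_nonneg _) (sq_lt_of_mem_OmegaMinus hv) (neg_poleSum_div_bounds h1 h2).2.le

theorem eq_of_norm_eq_of_Lam_zero_eq {v w : E2} (hv : v ∈ OmegaMinus) (hw : w ∈ OmegaMinus)
    (hn : ‖v‖ = ‖w‖) (h : Lam v 0 = Lam w 0) : v = w := by
  obtain ⟨hs, h1, h2, h4⟩ := mem_shell_of_mem_OmegaMinus hv
  have hs' := (mem_shell_of_mem_OmegaMinus hw).1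
  have p2 := poleSum_two_pos h4
  have hb := (neg_poleSum_div_bounds h1 h2).2
  have hqv := sq_lt_of_mem_OmegaMinus hv
  have hqw := sq_lt_of_mem_OmegaMinus hw
  have e := congrArg (fun x => x ^ 2) h
  simp only [Lam_zero_sq hs, Lam_zero_sq hs'] at e
  rw [← hn] at e hqw
  have e' := mul_left_cancel₀ (by positivity) e
  have hq : v 1 ^ 2 = w 1 ^ 2 := by
    rcases lt_trichotomy (v 1 ^ 2) (w 1 ^ 2) with hlt | heq | hlt
    · exact absurd e' (sq_mul_sub_lt (sq_nonneg _) hlt (by linarith)).ne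
    · exact heq
    · exact absurd e' (sq_mul_sub_lt (sq_nonneg _) hlt (by linarith)).ne'
  have e1 : v 1 = w 1 := by
    have := (pow_left_inj₀ (neg_nonneg.2 hv.1.le) (neg_nonneg.2 hw.1.le) two_ne_zero).1
      (by rw [neg_sq, neg_sq, hq])
    linarith
  have e0 : v 0 = w 0 := by
    have a := norm_sq_eq v
    have b := norm_sq_eq w
    rw [hn] at a
    exact (pow_left_inj₀ (pi_pos.trans hv.2.1).le (pi_pos.trans hw.2.1).le two_ne_zero).1
      (by linarith)
  ext i
  fin_cases i
  · exact e0
  · exact e1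

theorem exists_mem_OmegaMinus {y c : ℝ} (h1 : π ^ 2 < y) (h2 : y < vartheta1 ^ 2) (hc : 0 < c)
    (hcb : c ^ 2 < 16 * boundaryVal y) :
    ∃ x ∈ OmegaMinus, ‖x‖ ^ 2 = y ∧ Lam x 0 = c := by
  have hpi := pi_pos
  have h4 := h2.trans (sq_lt_of_lt_vartheta1 (pi_pos.trans pi_lt_vartheta1).le le_rfl)
  have p2 := poleSum_two_pos h4
  obtain ⟨hb0, hb1⟩ := neg_poleSum_div_bounds h1 h2
  rw [sixteen_mul_boundaryVal h4] at hcb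
  have hcont : ContinuousOn (fun q : ℝ => 16 * poleSum 2 y ^ 2 * (q ^ 2 * (y - q)))
      (Icc 0 (-poleSum 1 y / poleSum 2 y)) := by fun_prop
  -- Along the circle Λ₁² runs from 0 at q = 0 to 16 `boundaryVal y` at q = -S₁ / S₂, where K₃
  -- vanishes.
  obtain ⟨q, ⟨hq0, hq1⟩, hq⟩ := intermediate_value_Ioo hb0.le hcont
    ⟨by simp; positivity, hcb⟩
  simp only at hq
  have hyq : 0 < y - q := by linarith
  set x : E2 := !₂[√(y - q), -√q] with hx
  have hx0 : x 0 = √(y - q) := rfl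
  have hx1 : x 1 = -√q := rfl
  have hq1' : x 1 ^ 2 = q := by rw [hx1, neg_sq, Real.sq_sqrt hq0.le]
  have hn : ‖x‖ ^ 2 = y := by
    rw [norm_sq_eq, hq1', hx0, Real.sq_sqrt hyq.le]
    ring
  have hθ := pi_pos.trans pi_lt_vartheta1
  have hxm : x ∈ OmegaMinus := by
    refine mem_OmegaMinus (Real.sqrt_nonneg _) (neg_lt_zero.2 (Real.sqrt_pos.2 hq0)) ?_ ?_ ?_
    · exact lt_of_pow_lt_pow_left₀ 2 (norm_nonneg _) (hn.symm ▸ h1)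
    · exact lt_of_pow_lt_pow_left₀ 2 hθ.le (hn.symm ▸ h2)
    · rw [hn, hq1']
      rw [lt_div_iff₀ p2] at hq1
      linarith
  refine ⟨x, hxm, hn, ?_⟩
  have hs := (mem_shell_of_mem_OmegaMinus hxm).1
  have hpos := (mem_R2Lt_iff.1 (mapsTo_OmegaMinus hxm)).1
  refine (pow_left_inj₀ hpos.le hc.le two_ne_zero).1 ?_
  rw [Lam_zero_sq hs, hn, hq1', hq]

/-! #### Injectivity -/

/-- The part of a level set of the first component of `Lam` in an annulus. -/
def levelArc (r s c : ℝ) : Set E2 := {x | x ∈ OmegaMinus ∧ r ≤ ‖x‖ ∧ ‖x‖ ≤ s ∧ Lam x 0 = c}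

/-- The arc could fail to be closed only by reaching v₂ = 0, where Λ₁ = 0 ≠ c, or K₃ = 0, where Λ₁²
= 16 `boundaryVal` (|x|²) ≥ 16 `boundaryVal` (s²) > c². -/
theorem isCompact_levelArc {r s c : ℝ} (hr : π < r) (hs : s < vartheta1) (hc : 0 < c)
    (hcb : c ^ 2 < 16 * boundaryVal (s ^ 2)) : IsCompact (levelArc r s c) := by
  have hpi := pi_pos
  have c0 := continuous_coord 0
  have c1 := continuous_coord 1
  let N : Set E2 := {x | 0 ≤ x 0 ∧ x 1 ≤ 0 ∧ r ≤ ‖x‖ ∧ ‖x‖ ≤ s}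
  have hNc : IsClosed N :=
    (isClosed_le continuous_const c0).inter ((isClosed_le c1 continuous_const).inter
      ((isClosed_le continuous_const continuous_norm).inter
        (isClosed_le continuous_norm continuous_const)))
  have hNk : IsCompact N := (isCompact_closedBall (0 : E2) s).of_isClosed_subset hNc
    fun x hx => mem_closedBall_zero_iff.2 hx.2.2.2
  have hNs : N ⊆ shell 1 := fun x hx =>
    ⟨by linarith [hx.2.2.1], by linarith [hx.2.2.2, vartheta1_lt_two_pi],
      (hr.trans_le hx.2.2.1).ne'⟩
  have hf : ContinuousOn
      (fun x : E2 => (poleSum 1 (‖x‖ ^ 2) + x 1 ^ 2 * poleSum 2 (‖x‖ ^ 2), Lam x 0)) N := by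
    intro x hx
    obtain ⟨-, h2, h1⟩ := hNs hx
    have hL : ContinuousAt (fun x => Lam x 0) x :=
      (c0.continuousAt).comp (analyticAt_Lam (hNs hx)).continuousAt
    exact (((continuousAt_poleSum_norm_sq 0 h2 h1).add
      ((c1.pow 2).continuousAt.mul (continuousAt_poleSum_norm_sq 1 h2 h1))).prodMk
        hL).continuousWithinAt
  have hclosed := hf.preimage_isClosed_of_isClosed hNc
    ((isClosed_Iic (a := (0 : ℝ))).prod (isClosed_singleton (x := c)))
  have heq : levelArc r s c = N ∩ (fun x : E2 =>
      (poleSum 1 (‖x‖ ^ 2) + x 1 ^ 2 * poleSum 2 (‖x‖ ^ 2), Lam x 0)) ⁻¹' (Iic 0 ×ˢ {c}) := by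
    ext x
    constructor
    · rintro ⟨hx, h1, h2, h3⟩
      exact ⟨⟨(hpi.trans hx.2.1).le, hx.1.le, h1, h2⟩, (OmegaMinus_K3 hx).le, h3⟩
    · rintro ⟨hxN, hK, hL⟩
      have hK : poleSum 1 (‖x‖ ^ 2) + x 1 ^ 2 * poleSum 2 (‖x‖ ^ 2) ≤ 0 := hK
      have hL : Lam x 0 = c := hL
      have hxs := hNs hxN
      obtain ⟨h0, h1, h2, h3⟩ := hxN
      refine ⟨?_, h2, h3, hL⟩
      have hn : π < ‖x‖ := hr.trans_le h2
      have hn' : ‖x‖ < vartheta1 := h3.trans_lt hs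
      have h4 := sq_lt_of_lt_vartheta1 (norm_nonneg x) hn'.le
      have p2 := poleSum_two_pos h4
      refine mem_OmegaMinus h0 (lt_of_le_of_ne h1 fun hz => ?_) hn hn'
        (lt_of_le_of_ne hK fun hz => ?_)
      · rw [Lam_zero hxs, hz] at hL
        simp at hL
        exact hc.ne hL
      · have hq : x 1 ^ 2 = -poleSum 1 (‖x‖ ^ 2) / poleSum 2 (‖x‖ ^ 2) := by
          rw [eq_div_iff p2.ne']
          linarith
        have hsq := Lam_zero_sq hxs
        rw [hq, ← sixteen_mul_boundaryVal h4, hL] at hsq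
        have hmono : boundaryVal (s ^ 2) ≤ boundaryVal (‖x‖ ^ 2) :=
          strictAntiOn_boundaryVal.antitoneOn ⟨by gcongr, by gcongr⟩
            ⟨pow_lt_pow_left₀ (hn.trans_le h3) hpi.le two_ne_zero,
              pow_lt_pow_left₀ hs ((norm_nonneg x).trans h3) two_ne_zero⟩ (by gcongr)
        linarith
  rw [heq]
  exact hNk.of_isClosed_subset hclosed inter_subset_left

/-- Λ is open at p, so the image of U contains a short vertical segment through Λ(p): Λ₂ has no
local extremum on a level set of Λ₁. -/
theorem exists_lt_gt_near {p : E2} (hp : p ∈ OmegaMinus) {U : Set E2} (hU : U ∈ 𝓝 p) :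
    (∃ x ∈ U, Lam x 0 = Lam p 0 ∧ Lam p 1 < Lam x 1) ∧
      ∃ x ∈ U, Lam x 0 = Lam p 0 ∧ Lam x 1 < Lam p 1 := by
  have himg : Lam '' U ∈ 𝓝 (Lam p) := by
    rw [← map_nhds_Lam (mem_shell_of_mem_OmegaMinus hp).1 (potentialHess_det_neg hp).ne]
    exact image_mem_map hU
  have hc : ContinuousAt (fun t : ℝ => Lam p + t • (EuclideanSpace.single 1 (1 : ℝ) : E2)) 0 := by
    fun_prop
  have hev : ∀ᶠ t : ℝ in 𝓝 0,
      Lam p + t • (EuclideanSpace.single 1 (1 : ℝ) : E2) ∈ Lam '' U :=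
    hc.eventually_mem (by simpa using himg)
  constructor
  · obtain ⟨t, ⟨x, hx, hxt⟩, ht⟩ :=
      ((hev.filter_mono (nhdsWithin_le_nhds (s := Ioi 0))).and self_mem_nhdsWithin).exists
    have ht : 0 < t := ht
    exact ⟨x, hx, by simp [hxt], by simpa [hxt] using ht⟩
  · obtain ⟨t, ⟨x, hx, hxt⟩, ht⟩ :=
      ((hev.filter_mono (nhdsWithin_le_nhds (s := Iio 0))).and self_mem_nhdsWithin).exists
    have ht : t < 0 := ht
    exact ⟨x, hx, by simp [hxt], by simpa [hxt] using ht⟩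

theorem not_norm_lt_of_Lam_eq {v w : E2} (hv : v ∈ OmegaMinus) (hw : w ∈ OmegaMinus)
    (h : Lam v = Lam w) : ¬ ‖v‖ < ‖w‖ := by
  intro hlt
  have hpi := pi_pos
  have hrv : π < ‖v‖ := hv.2.1.trans hv.2.2.1
  have hrw : ‖w‖ < vartheta1 := hw.2.2.2.1
  obtain ⟨hc, -, -⟩ := mem_R2Lt_iff.1 (mapsTo_OmegaMinus hw)
  have hcb := Lam_zero_sq_lt hw
  have hcomp := isCompact_levelArc hrv hrw hc hcb
  have hcont : ContinuousOn (fun x => Lam x 1) (levelArc ‖v‖ ‖w‖ (Lam w 0)) := fun x hx =>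
    ((continuous_coord 1).continuousAt.comp
      (analyticAt_Lam (mem_shell_of_mem_OmegaMinus hx.1).1).continuousAt).continuousWithinAt
  obtain ⟨y, hy1, hy2⟩ := exists_between (pow_lt_pow_left₀ hlt (norm_nonneg v) two_ne_zero)
  have hyπ : π ^ 2 < y := (pow_lt_pow_left₀ hrv hpi.le two_ne_zero).trans hy1
  have hyw : ‖w‖ ^ 2 < vartheta1 ^ 2 := pow_lt_pow_left₀ hrw (norm_nonneg w) two_ne_zero
  -- A point of the arc strictly between the end circles; monotonicity of `boundaryVal` keeps the
  -- level c attainable on the intermediate circle.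
  obtain ⟨x, hx, hxn, hxc⟩ := exists_mem_OmegaMinus hyπ (hy2.trans hyw) hc
    (hcb.trans (mul_lt_mul_of_pos_left
      (strictAntiOn_boundaryVal ⟨hyπ, hy2.trans hyw⟩ ⟨hyπ.trans hy2, hyw⟩ hy2) (by norm_num)))
  have hx1 : ‖v‖ < ‖x‖ := lt_of_pow_lt_pow_left₀ 2 (norm_nonneg _) (hxn.symm ▸ hy1)
  have hx2 : ‖x‖ < ‖w‖ := lt_of_pow_lt_pow_left₀ 2 (norm_nonneg _) (hxn.symm ▸ hy2)
  have hxL : x ∈ levelArc ‖v‖ ‖w‖ (Lam w 0) := ⟨hx, hx1.le, hx2.le, hxc⟩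
  have hinterior : ∀ p ∈ levelArc ‖v‖ ‖w‖ (Lam w 0), ‖v‖ < ‖p‖ → ‖p‖ < ‖w‖ →
      (∃ z ∈ levelArc ‖v‖ ‖w‖ (Lam w 0), Lam p 1 < Lam z 1) ∧
        ∃ z ∈ levelArc ‖v‖ ‖w‖ (Lam w 0), Lam z 1 < Lam p 1 := by
    intro p hp h1 h2
    have hU : OmegaMinus ∩ {z : E2 | ‖v‖ < ‖z‖ ∧ ‖z‖ < ‖w‖} ∈ 𝓝 p :=
      (isOpen_OmegaMinus.inter ((isOpen_lt continuous_const continuous_norm).inter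
        (isOpen_lt continuous_norm continuous_const))).mem_nhds ⟨hp.1, h1, h2⟩
    obtain ⟨⟨a, ha, ha0, ha1⟩, ⟨b, hb, hb0, hb1⟩⟩ := exists_lt_gt_near hp.1 hU
    exact ⟨⟨a, ⟨ha.1, ha.2.1.le, ha.2.2.le, ha0.trans hp.2.2.2⟩, ha1⟩,
      ⟨b, ⟨hb.1, hb.2.1.le, hb.2.2.le, hb0.trans hp.2.2.2⟩, hb1⟩⟩
  -- On the end circles the arc contains only v and w, which share the value of Λ₂.
  have hboundary : ∀ p ∈ levelArc ‖v‖ ‖w‖ (Lam w 0), ¬ (‖v‖ < ‖p‖ ∧ ‖p‖ < ‖w‖) →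
      Lam p 1 = Lam w 1 := by
    rintro p ⟨hp, h1, h2, h3⟩ hcon
    rcases h1.lt_or_eq with h1 | h1
    · rcases h2.lt_or_eq with h2 | h2
      · exact absurd ⟨h1, h2⟩ hcon
      · rw [eq_of_norm_eq_of_Lam_zero_eq hp hw h2 h3]
    · rw [← h, eq_of_norm_eq_of_Lam_zero_eq hv hp h1 (by rw [h, h3])]
  rcases le_total (Lam w 1) (Lam x 1) with hle | hle
  · obtain ⟨m, hm, hmax⟩ := hcomp.exists_isMaxOn ⟨x, hxL⟩ hcont
    by_cases hmi : ‖v‖ < ‖m‖ ∧ ‖m‖ < ‖w‖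
    · obtain ⟨⟨z, hz, hlt⟩, -⟩ := hinterior m hm hmi.1 hmi.2
      exact (hmax hz).not_gt hlt
    · obtain ⟨⟨z, hz, hlt⟩, -⟩ := hinterior x hxL hx1 hx2
      have h1 := hboundary m hm hmi
      have h2 : Lam z 1 ≤ Lam m 1 := hmax hz
      linarith
  · obtain ⟨m, hm, hmin⟩ := hcomp.exists_isMinOn ⟨x, hxL⟩ hcont
    by_cases hmi : ‖v‖ < ‖m‖ ∧ ‖m‖ < ‖w‖
    · obtain ⟨-, ⟨z, hz, hlt⟩⟩ := hinterior m hm hmi.1 hmi.2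
      exact (hmin hz).not_gt hlt
    · obtain ⟨-, ⟨z, hz, hlt⟩⟩ := hinterior x hxL hx1 hx2
      have h1 := hboundary m hm hmi
      have h2 : Lam m 1 ≤ Lam z 1 := hmin hz
      linarith

theorem injOn_OmegaMinus : InjOn Lam OmegaMinus := by
  intro v hv w hw h
  rcases lt_trichotomy ‖v‖ ‖w‖ with hlt | heq | hlt
  · exact absurd hlt (not_norm_lt_of_Lam_eq hv hw h)
  · exact eq_of_norm_eq_of_Lam_zero_eq hv hw heq (by rw [h])
  · exact absurd hlt (not_norm_lt_of_Lam_eq hw hv h.symm)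

theorem nonempty_OmegaMinus : OmegaMinus.Nonempty := by
  obtain ⟨y, h1, h2⟩ := exists_between
    (pow_lt_pow_left₀ pi_lt_vartheta1 pi_pos.le two_ne_zero)
  have h4 := h2.trans (sq_lt_of_lt_vartheta1 (pi_pos.trans pi_lt_vartheta1).le le_rfl)
  obtain ⟨hb0, hb1⟩ := neg_poleSum_div_bounds h1 h2
  have p2 := poleSum_two_pos h4
  have hpos : 0 < 16 * boundaryVal y := by
    rw [sixteen_mul_boundaryVal h4]
    have : 0 < y - -poleSum 1 y / poleSum 2 y := by linarith
    positivity
  obtain ⟨c, hc0, hc⟩ := exists_between (Real.sqrt_pos.2 hpos)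
  obtain ⟨x, hx, -⟩ := exists_mem_OmegaMinus h1 h2 hc0 ((Real.lt_sqrt hc0.le).1 hc)
  exact ⟨x, hx⟩

theorem isAnalyticDiffeoOn_OmegaMinus : IsAnalyticDiffeoOn Lam OmegaMinus R2Lt :=
  isAnalyticDiffeoOn_Lam isOpen_OmegaMinus isOpen_R2Lt
    (fun _ hv => (mem_shell_of_mem_OmegaMinus hv).1) (fun _ hv => (potentialHess_det_neg hv).ne)
    nonempty_OmegaMinus mapsTo_OmegaMinus injOn_OmegaMinus isPreconnected_R2Lt
    closure_image_OmegaMinus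

end FreeCarnot

theorem theorem2p1 :
    -- on its domain the map is the gradient of `v ↦ v₂² ψ(|v|)`
    (∀ v : FreeCarnot.E2, 0 < ‖v‖ → ‖v‖ ≠ Real.pi → ‖v‖ < FreeCarnot.vartheta1 →
      HasGradientAt (fun w : FreeCarnot.E2 => w 1 ^ 2 * FreeCarnot.psi ‖w‖)
        (FreeCarnot.Lam v) v) ∧
    -- first diffeomorphism
    FreeCarnot.IsAnalyticDiffeoOn FreeCarnot.Lam FreeCarnot.OmegaPlus FreeCarnot.R2Gt ∧
    (∀ u ∈ FreeCarnot.R2Gt,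
      ContDiffAt ℝ 2 (FreeCarnot.phi (FreeCarnot.gOf u))
        (FreeCarnot.thetaOf FreeCarnot.OmegaPlus u) ∧
      (FreeCarnot.hessian (fun τ => -FreeCarnot.phi (FreeCarnot.gOf u) τ)
        (FreeCarnot.thetaOf FreeCarnot.OmegaPlus u)).PosDef) ∧
    -- second diffeomorphism
    FreeCarnot.IsAnalyticDiffeoOn FreeCarnot.Lam FreeCarnot.OmegaMinus FreeCarnot.R2Lt ∧
    (∀ u ∈ FreeCarnot.R2Lt,
      ContDiffAt ℝ 2 (FreeCarnot.phi (FreeCarnot.gOf u))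
        (FreeCarnot.thetaOf FreeCarnot.OmegaMinus u) ∧
      (FreeCarnot.hessian (FreeCarnot.phi (FreeCarnot.gOf u))
        (FreeCarnot.thetaOf FreeCarnot.OmegaMinus u)).det ≠ 0 ∧
      -- exactly two positive eigenvalues, counted with multiplicity
      ∃ hH : (FreeCarnot.hessian (FreeCarnot.phi (FreeCarnot.gOf u))
          (FreeCarnot.thetaOf FreeCarnot.OmegaMinus u)).IsHermitian,
        (Finset.univ.filter fun i : Fin 3 => 0 < hH.eigenvalues i).card = 2) := by
  have hplus := FreeCarnot.isAnalyticDiffeoOn_OmegaPlus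
  have hminus := FreeCarnot.isAnalyticDiffeoOn_OmegaMinus
  refine ⟨fun v h0 h1 h2 =>
    FreeCarnot.hasGradientAt_Lam ⟨h0, h2.trans FreeCarnot.vartheta1_lt_two_pi, h1⟩,
    hplus, fun u hu => ?_, hminus, fun u hu => ?_⟩
  · have hv := Function.invFunOn_mem (hplus.bijOn.surjOn hu)
    exact ⟨FreeCarnot.contDiffAt_phi u
        (FreeCarnot.embed_mem_shell (FreeCarnot.mem_shell_of_mem_OmegaPlus hv).1),
      FreeCarnot.hessian_neg_phi_posDef u hv⟩
  · have hv := Function.invFunOn_mem (hminus.bijOn.surjOn hu)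
    have hs := (FreeCarnot.mem_shell_of_mem_OmegaMinus hv).1
    have hdet := FreeCarnot.hessian_phi_det_neg u hv
    have hH := FreeCarnot.hessian_phi_isHermitian u hs
    exact ⟨FreeCarnot.contDiffAt_phi u (FreeCarnot.embed_mem_shell hs), hdet.ne, hH,
      FreeCarnot.card_pos_eigenvalues_eq_two hH hdet (FreeCarnot.hessian_phi_two_two_pos u hv)⟩
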